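/- Let $d$ be a natural number and $\hbar>0$. For $g,h\in\mathcal S(\mathbb R^d)$ put $\langle h,g\rangle=\int_{\mathbb R^d} h(y)\overline{g(y)}\,dy$, and for $u\in\mathcal S'(\mathbb R^d)$ put $\langle u,g\rangle=u(\overline g)$. For $x,\xi\in\mathbb R^d$ let $$\pi(x,\xi)g(y)=(2\pi\hbar)^{-d/2}e^{\frac{i}{\hbar}\xi\cdot y}g(y-x),\qquad V_gu(x,\xi)=\langle u,\pi(x,\xi)g\rangle,\qquad \mathcal V_gu(x,\xi)=\overline{V_g\overline u(x,\xi)},$$ where $\overline u(\phi)=\overline{u(\overline\phi)}$. The Sjöstrand class $M^{\infty,1}(\mathbb R^d)$ consists of all $u\in\mathcal S'(\mathbb R^d)$ such that $\int_{\mathbb R^d}\sup_{x\in\mathbb R^d}|V_gu(x,\xi)|\,d\xi<\infty$ for some $g\in\mathcal S(\mathbb R^d)\setminus\{0\}$. Let $F_+(x)=(2\pi i\hbar)^{-d/2}e^{\frac{i}{2\hbar}|x|^2}$ (principal branch of the power), regarded also as a tempered distribution. A function $f:\mathbb R^d\to\mathbb C$ is called Fresnel integrable if there is a number $L\in\mathbb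 C$ such that, for every $\varphi\in\mathcal S(\mathbb R^d)$ with $\varphi(0)=1$, the function $x\mapsto e^{\frac{i}{2\hbar}|x|^2}f(x)\varphi(\varepsilon x)$ is Lebesgue integrable for every $\varepsilon>0$ and $$\lim_{\varepsilon\downarrow0}\,(2\pi i\hbar)^{-d/2}\int_{\mathbb R^d}e^{\frac{i}{2\hbar}|x|^2}f(x)\varphi(\varepsilon x)\,dx=L;$$ in particular the limit does not depend on $\varphi$. One then writes $\widetilde{\int_{\mathbb R^d}}e^{\frac{i}{2\hbar}|x|^2}f(x)\,dx=L$. **Theorem.** Every $u\in M^{\infty,1}(\mathbb R^d)$ is given by a bounded continuous function. Moreover, every function $f:\mathbb R^d\to\mathbb C$ that gives $u$ (that is, $\phi f$ is Lebesgue integrable and $u(\phi)=\int\phi f\,dx$ for all $\phi\in\mathcal S(\mathbb R^d)$) is Fresnel integrable, and for all $g,\gamma\in\mathcal S(\mathbb R^d)$ with $\langle\gamma,g\rangle\neq0$ the function $(x,\xi)\mapsto V_gF_+(x,\xi)\,\mathcal V_\gamma u(x,\xi)$ is Lebesgue integrable on $\mathbb R^{2d}$ and $$\widetilde{\int_{\mathbb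 R^d}}e^{\frac{i}{2\hbar}|x|^2}f(x)\,dx=\frac1{\langle\gamma,g\rangle}\int_{\mathbb R^{2d}}V_gF_+(x,\xi)\,\mathcal V_\gamma u(x,\xi)\,dx\,d\xi .$$ -/

import Mathlib

open MeasureTheory Filter Topology SchwartzMap

noncomputable section

namespace FresnelSjostrand

/-- The Euclidean space `ℝ^d`. -/
abbrev Rd (d : ℕ) : Type := EuclideanSpace ℝ (Fin d)

/-! ### Schwartz functions -/

section Schwartz

variable {d : ℕ}

/-- The bracket `⟨f, g⟩ = ∫ f(y) conj(g(y)) dy` of two Schwartz functions. -/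
def bracket (f g : 𝓢(Rd d, ℂ)) : ℂ :=
  ∫ y, f y * (starRingEnd ℂ) (g y)

/-- Pointwise complex conjugation of a Schwartz function. -/
def conjS : 𝓢(Rd d, ℂ) →L[ℝ] 𝓢(Rd d, ℂ) :=
  SchwartzMap.postcompCLM (𝕜 := ℝ) (Complex.conjCLE : ℂ →L[ℝ] ℂ)

@[simp]
theorem conjS_apply (g : 𝓢(Rd d, ℂ)) (y : Rd d) : conjS g y = (starRingEnd ℂ) (g y) := rfl

/-- The plane wave `y ↦ exp ((i / ħ) ξ · y)`. -/
def planeWave (ħ : ℝ) (ξ y : Rd d) : ℂ :=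
  Complex.exp (Complex.I / (ħ : ℂ) * (inner ℝ ξ y : ℝ))

theorem hasTemperateGrowth_cexp_I : (fun t : ℝ => Complex.exp (Complex.I * (t : ℂ))).HasTemperateGrowth := by
  have hd : ∀ n : ℕ, iteratedDeriv n (fun t : ℝ => Complex.exp (Complex.I * (t : ℂ)))
      = fun t : ℝ => Complex.I ^ n * Complex.exp (Complex.I * (t : ℂ)) := by
    intro n
    induction n with
    | zero => simp
    | succ n ih =>
      rw [iteratedDeriv_succ, ih]
      funext t
      have h1 : HasDerivAt (fun t : ℝ => Complex.I * (t : ℂ)) (Complex.I * 1) t :=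
        (Complex.ofRealCLM.hasDerivAt (x := t)).const_mul Complex.I
      have h2 := (h1.cexp).const_mul (Complex.I ^ n)
      rw [h2.deriv]
      ring
  refine ⟨?_, fun n => ⟨0, 1, fun t => ?_⟩⟩
  · exact (contDiff_const.mul Complex.ofRealCLM.contDiff).cexp
  · rw [norm_iteratedFDeriv_eq_norm_iteratedDeriv, hd]
    have : ‖Complex.exp (Complex.I * (t : ℂ))‖ = 1 := by
      rw [mul_comm]; exact Complex.norm_exp_ofReal_mul_I t
    simp [this]

theorem hasTemperateGrowth_planeWave (ħ : ℝ) (ξ : Rd d) :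
    (planeWave ħ ξ).HasTemperateGrowth := by
  have h : (fun y : Rd d => ħ⁻¹ * inner ℝ ξ y).HasTemperateGrowth := by fun_prop
  have h' := hasTemperateGrowth_cexp_I.comp h
  convert h' using 1
  funext y
  simp only [planeWave, Function.comp]
  congr 1
  push_cast
  ring

/-- The phase space shift `π(x, ξ) g = M_ξ T_x g` of a Schwartz function, where
`T_x g(y) = g(y - x)` and `M_ξ g(y) = (2πħ)^{-d/2} exp((i/ħ) ξ · y) g(y)`. -/
def phaseShift (ħ : ℝ) (x ξ : Rd d) (g : 𝓢(Rd d, ℂ)) : 𝓢(Rd d, ℂ) :=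
  (((2 * Real.pi * ħ) ^ (-(d : ℝ) / 2) : ℝ) : ℂ) •
    SchwartzMap.smulLeftCLM ℂ (planeWave ħ ξ) (SchwartzMap.compSubConstCLM ℂ x g)

theorem phaseShift_apply (ħ : ℝ) (x ξ : Rd d) (g : 𝓢(Rd d, ℂ)) (y : Rd d) :
    phaseShift ħ x ξ g y = (((2 * Real.pi * ħ) ^ (-(d : ℝ) / 2) : ℝ) : ℂ) *
      (Complex.exp (Complex.I / (ħ : ℂ) * (inner ℝ ξ y : ℝ)) * g (y - x)) := by
  simp [phaseShift, SchwartzMap.smulLeftCLM_apply_apply (hasTemperateGrowth_planeWave ħ ξ),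
    planeWave]

end Schwartz

/-! ### Tempered distributions and the Gabor transform -/

section Gabor

variable {d : ℕ}

/-- The complex conjugate of a tempered distribution: `⟨conj u, φ⟩ = conj ⟨u, conj φ⟩` for the
bilinear pairing of distributions with Schwartz functions. -/
def conjDist (u : 𝓢'(Rd d, ℂ)) : 𝓢'(Rd d, ℂ) :=
  ContinuousLinearMap.toPointwiseConvergenceCLM _ _ _ _
    { toFun := fun φ => (starRingEnd ℂ) (u (conjS φ))
      map_add' := fun φ ψ => by simp
      map_smul' := fun c φ => by
        have h : conjS (c • φ) = (starRingEnd ℂ) c • conjS φ := by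
          ext y; simp
        simp [h]
      cont := Complex.continuous_conj.comp
        ((map_continuous u).comp (conjS (d := d)).continuous) }

theorem conjDist_apply (u : 𝓢'(Rd d, ℂ)) (φ : 𝓢(Rd d, ℂ)) :
    conjDist u φ = (starRingEnd ℂ) (u (conjS φ)) := rfl

/-- The Gabor transform `V_g u(x, ξ) = ⟨u, π(x, ξ) g⟩` of a tempered distribution, where the
bracket is the sesquilinear one, `⟨u, φ⟩ = u(conj φ)`. -/
def gabor (ħ : ℝ) (g : 𝓢(Rd d, ℂ)) (u : 𝓢'(Rd d, ℂ)) (x ξ : Rd d) : ℂ :=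
  u (conjS (phaseShift ħ x ξ g))

/-- The conjugate Gabor transform `𝒱_g u(x, ξ) = conj (V_g (conj u) (x, ξ))`. -/
def gaborConj (ħ : ℝ) (g : 𝓢(Rd d, ℂ)) (u : 𝓢'(Rd d, ℂ)) (x ξ : Rd d) : ℂ :=
  (starRingEnd ℂ) (gabor ħ g (conjDist u) x ξ)

theorem gaborConj_eq (ħ : ℝ) (g : 𝓢(Rd d, ℂ)) (u : 𝓢'(Rd d, ℂ)) (x ξ : Rd d) :
    gaborConj ħ g u x ξ = u (phaseShift ħ x ξ g) := by
  have h : conjS (conjS (phaseShift ħ x ξ g)) = phaseShift ħ x ξ g := by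
    ext y; simp
  simp [gaborConj, gabor, conjDist_apply, h]

/-- The Sjöstrand class `M^{∞,1}(ℝ^d)`: the tempered distributions `u` for which
`∫ sup_x |V_g u(x, ξ)| dξ < ∞` for some window `g ∈ 𝓢(ℝ^d) \ {0}`. -/
def sjostrandClass (ħ : ℝ) (d : ℕ) : Set 𝓢'(Rd d, ℂ) :=
  {u | ∃ g : 𝓢(Rd d, ℂ), g ≠ 0 ∧ ∫⁻ ξ : Rd d, ⨆ x : Rd d, ‖gabor ħ g u x ξ‖ₑ < ⊤}

/-- The tempered distribution `u` is (given by) the function `f`. -/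
def IsGivenBy (u : 𝓢'(Rd d, ℂ)) (f : Rd d → ℂ) : Prop :=
  ∀ φ : 𝓢(Rd d, ℂ), Integrable (fun x => φ x * f x) ∧ u φ = ∫ x, φ x * f x

end Gabor

/-! ### Fresnel integrals -/

section Fresnel

/-- The Fresnel function `F₊(x) = (2πiħ)^{-d/2} exp((i/2ħ)|x|²)` (principal branch). -/
def fresnelFun (ħ : ℝ) (d : ℕ) (x : Rd d) : ℂ :=
  (2 * (Real.pi : ℂ) * Complex.I * (ħ : ℂ)) ^ (-(d : ℂ) / 2) *
    Complex.exp (Complex.I / (2 * (ħ : ℂ)) * ((‖x‖ ^ 2 : ℝ) : ℂ))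

theorem memLp_fresnelFun (ħ : ℝ) (d : ℕ) : MemLp (fresnelFun ħ d) ⊤ volume := by
  refine memLp_top_of_bound (Continuous.aestronglyMeasurable ?_)
    ‖(2 * (Real.pi : ℂ) * Complex.I * (ħ : ℂ)) ^ (-(d : ℂ) / 2)‖
    (Eventually.of_forall fun x => ?_)
  · unfold fresnelFun
    fun_prop
  · have h : Complex.I / (2 * (ħ : ℂ)) * ((‖x‖ ^ 2 : ℝ) : ℂ)
        = ((‖x‖ ^ 2 / (2 * ħ) : ℝ) : ℂ) * Complex.I := by
      push_cast; ring
    rw [fresnelFun, norm_mul, h, Complex.norm_exp_ofReal_mul_I, mul_one]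

/-- The bounded function `F₊` as a tempered distribution, `φ ↦ ∫ φ(x) F₊(x) dx`. -/
def fresnelDist (ħ : ℝ) (d : ℕ) : 𝓢'(Rd d, ℂ) :=
  Lp.toTemperedDistribution ((memLp_fresnelFun ħ d).toLp)

theorem fresnelDist_apply (ħ : ℝ) (d : ℕ) (φ : 𝓢(Rd d, ℂ)) :
    fresnelDist ħ d φ = ∫ x, φ x * fresnelFun ħ d x := by
  rw [fresnelDist, Lp.toTemperedDistribution_apply]
  refine integral_congr_ae ?_
  filter_upwards [(memLp_fresnelFun ħ d).coeFn_toLp] with x hx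
  rw [hx, smul_eq_mul]

variable {d : ℕ}

/-- The function `f` has Fresnel integral `L`: for every `φ ∈ 𝓢(ℝ^d)` with `φ(0) = 1`, the
regularized integrals `(2πiħ)^{-d/2} ∫ exp((i/2ħ)|x|²) f(x) φ(εx) dx` are Lebesgue integrals,
and they converge to `L` as `ε ↓ 0`. -/
def HasFresnelIntegral (ħ : ℝ) (f : Rd d → ℂ) (L : ℂ) : Prop :=
  ∀ φ : 𝓢(Rd d, ℂ), φ 0 = 1 →
    (∀ ε : ℝ, 0 < ε → Integrable fun x : Rd d =>
      Complex.exp (Complex.I / (2 * (ħ : ℂ)) * ((‖x‖ ^ 2 : ℝ) : ℂ)) * f x * φ (ε • x)) ∧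
    Tendsto (fun ε : ℝ => (2 * (Real.pi : ℂ) * Complex.I * (ħ : ℂ)) ^ (-(d : ℂ) / 2) *
      ∫ x : Rd d, Complex.exp (Complex.I / (2 * (ħ : ℂ)) * ((‖x‖ ^ 2 : ℝ) : ℂ)) * f x * φ (ε • x))
      (𝓝[>] 0) (𝓝 L)

/-- `f` is Fresnel integrable: the limit of the regularized integrals exists for every cutoff
`φ`, and it is the same for all of them. -/
def FresnelIntegrable (ħ : ℝ) (f : Rd d → ℂ) : Prop :=
  ∃ L : ℂ, HasFresnelIntegral ħ f L

end Fresnel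

end FresnelSjostrand

end

open FresnelSjostrand

noncomputable section

namespace FresnelSjostrand

open scoped FourierTransform ENNReal

/-! ### Integrals of Schwartz-valued families -/

section SchwartzIntegral

variable {Z : Type*} [TopologicalSpace Z] [SecondCountableTopology Z] [MeasurableSpace Z]
  [OpensMeasurableSpace Z] {μ : Measure Z}

/-! The formula is Parseval's identity for the short-time Fourier transform, carried to a limit. For
integrable `Ψ` and bounded continuous `f`, `integral_stft_mul_stft` gives `⟨γ, g⟩ ∫ Ψ f` as the
phase space integral of the transform of `Ψ` against that of `f`. It is applied to `Ψ = F₊ φ(ε ·)`,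
and `ε ↓ 0` is taken under the integral by dominated convergence.

The majorant comes from the chirp structure of `F₊`. Translating `F₊` by `x` multiplies it by the
plane wave of frequency `x / (2πħ)` and a unimodular constant (`fresnelFun_add`), so the transform
of `F₊ φ(ε ·)` decays rapidly in `ω - x / (2πħ)`, uniformly for `|ε| ≤ 1`
(`exists_norm_stft_fresnelCutoff_le`). Its integral over `x` is then bounded independently of `ω`,
while the transform of `f` has a supremum over `x` that is integrable in `ω`: exactly the Sjöstrand
condition. The limit involves only the transform of `F₊`, hence does not depend on `φ`.

Three facts prepare this. First, `u` is a bounded continuous function: each localization `γ(· - x)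
u` has an integrable Fourier transform, and the resulting functions are glued by integrating over
`x` (`exists_boundedContinuous_isGivenBy`). Secondly, the Sjöstrand condition passes to every
window, since a change of window bounds the new supremum by a convolution of the old one with an
integrable weight (`lintegral_stftSup_lt_top`). Thirdly, distributions commute with integrals of
Schwartz-valued families (`temperedDistribution_integral`), which justifies the manipulations before
`u` is known to be a function.

Everything is done with unit frequencies `ω = ξ / (2πħ)`; the Jacobian of this substitution cancels
the normalization of the phase space shifts. -/

theorem continuous_seminorm_schwartz {V W : Type*} [NormedAddCommGroup V] [NormedSpace ℝ V]
    [NormedAddCommGroup W] [NormedSpace ℝ W] (k n : ℕ) :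
    Continuous fun φ : 𝓢(V, W) => SchwartzMap.seminorm ℝ k n φ :=
  (schwartz_withSeminorms ℝ V W).continuous_seminorm (k, n)

theorem continuous_eval_schwartz {V W : Type*} [NormedAddCommGroup V] [NormedSpace ℝ V]
    [NormedAddCommGroup W] [NormedSpace ℝ W] (y : V) : Continuous fun φ : 𝓢(V, W) => φ y :=
  (BoundedContinuousFunction.evalCLM ℝ y).continuous.comp
    (toBoundedContinuousFunctionCLM ℝ V W).continuous

/-- Differentiation under the integral sign, to all orders, for a continuous family of Schwartz
functions with integrable seminorms. -/
theorem iteratedFDeriv_integral_schwartz {V : Type} [NormedAddCommGroup V] [NormedSpace ℝ V]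
    (n : ℕ) : ∀ {W : Type} [NormedAddCommGroup W] [NormedSpace ℝ W] [CompleteSpace W]
    (G : Z → 𝓢(V, W)), Continuous G →
    (∀ m, Integrable (fun z => SchwartzMap.seminorm ℝ 0 m (G z)) μ) → ∀ y : V,
    iteratedFDeriv ℝ n (fun y => ∫ z, G z y ∂μ) y = ∫ z, iteratedFDeriv ℝ n (G z) y ∂μ := by
  -- `W` stays quantified because the induction step passes to the derivative, whose values lie in
  -- `V →L[ℝ] W`.
  induction n with
  | zero =>
    intro W _ _ _ G hG hint y
    ext m
    have h := ContinuousLinearMap.integral_comp_comm (μ := μ) (φ := fun z => G z y)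
      ((continuousMultilinearCurryFin0 ℝ V W).symm.toContinuousLinearEquiv : W →L[ℝ] V [×0]→L[ℝ] W)
      ?_
    · simp only [iteratedFDeriv_zero_eq_comp]
      exact congrArg (fun f => f m) h.symm
    · refine (hint 0).mono' ((continuous_eval_schwartz y).comp hG).aestronglyMeasurable
        (Eventually.of_forall fun z => norm_le_seminorm ℝ (G z) y)
  | succ n ih =>
    intro W _ _ _ G hG hint y
    have hG' : Continuous fun z => fderivCLM ℝ V W (G z) := (fderivCLM ℝ V W).continuous.comp hG
    have hint' : ∀ m, Integrable (fun z => SchwartzMap.seminorm ℝ 0 m (fderivCLM ℝ V W (G z))) μ := by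
      intro m
      refine (hint (m + 1)).mono' ((continuous_seminorm_schwartz 0 m).comp hG').aestronglyMeasurable
        (Eventually.of_forall fun z => ?_)
      rw [Real.norm_of_nonneg (apply_nonneg _ _)]
      refine seminorm_le_bound ℝ 0 m _ (apply_nonneg _ _) fun x => ?_
      have := le_seminorm ℝ 0 (m + 1) (G z) x
      rw [← norm_iteratedFDeriv_fderiv] at this
      exact this
    have hd : ∀ x, HasFDerivAt (fun y => ∫ z, G z y ∂μ) (∫ z, fderivCLM ℝ V W (G z) x ∂μ) x := by
      intro x
      refine hasFDerivAt_integral_of_dominated_of_fderiv_le (F' := fun y z => fderivCLM ℝ V W (G z) y)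
        (s := Set.univ) (bound := fun z => SchwartzMap.seminorm ℝ 0 0 (fderivCLM ℝ V W (G z)))
        univ_mem ?_ ?_ ?_ ?_ ?_ ?_
      · exact Eventually.of_forall fun y => ((continuous_eval_schwartz y).comp hG).aestronglyMeasurable
      · exact (hint 0).mono' ((continuous_eval_schwartz x).comp hG).aestronglyMeasurable
          (Eventually.of_forall fun z => norm_le_seminorm ℝ (G z) x)
      · exact ((continuous_eval_schwartz x).comp hG').aestronglyMeasurable
      · exact Eventually.of_forall fun z y _ => norm_le_seminorm ℝ _ y
      · exact hint' 0
      · exact Eventually.of_forall fun z y _ => (G z).hasFDerivAt y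
    have hfd : (fderiv ℝ fun y => ∫ z, G z y ∂μ) = fun y => ∫ z, fderivCLM ℝ V W (G z) y ∂μ :=
      funext fun x => (hd x).fderiv
    rw [iteratedFDeriv_succ_eq_comp_right, Function.comp_apply, hfd, ih _ hG' hint' y]
    simp only [iteratedFDeriv_succ_eq_comp_right, Function.comp_apply]
    exact ((continuousMultilinearCurryRightEquiv' ℝ n V W).symm.toContinuousLinearEquiv.integral_comp_comm
      (μ := μ) (φ := fun z => iteratedFDeriv ℝ n (fderivCLM ℝ V W (G z)) y)).symm

variable {V : Type} [NormedAddCommGroup V] [NormedSpace ℝ V]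

/-- Bounded continuous functions on `V` with values in the `n`-linear forms. -/
abbrev BoundedForms (V : Type) [NormedAddCommGroup V] [NormedSpace ℝ V] (n : ℕ) : Type :=
  @BoundedContinuousFunction V (V [×n]→L[ℝ] ℂ) _
    (NormedAddCommGroup.toSeminormedAddCommGroup (E := V [×n]→L[ℝ] ℂ)).toPseudoMetricSpace

theorem le_seminorm_weighted (k n : ℕ) (φ : 𝓢(V, ℂ)) (y : V) :
    ‖‖y‖ ^ k • iteratedFDeriv ℝ n φ y‖ ≤ SchwartzMap.seminorm ℝ k n φ := by
  rw [norm_smul, norm_pow, norm_norm]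
  exact le_seminorm ℝ k n φ y

/-- The weighted derivative `y ↦ ‖y‖ ^ k • D ^ n φ y` as a bounded continuous function. -/
def weightedDeriv (k n : ℕ) :
    𝓢(V, ℂ) →ₗ[ℂ] BoundedForms V n where
  toFun φ := BoundedContinuousFunction.ofNormedAddCommGroup
    (fun y => ‖y‖ ^ k • iteratedFDeriv ℝ n φ y)
    ((continuous_norm.pow k).smul ((φ.smooth n).continuous_iteratedFDeriv (m := n) le_rfl))
    (SchwartzMap.seminorm ℝ k n φ) (le_seminorm_weighted k n φ)
  map_add' φ ψ := by
    ext1 y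
    change ‖y‖ ^ k • iteratedFDeriv ℝ n (⇑φ + ⇑ψ) y = _
    rw [iteratedFDeriv_add_apply ((φ.smooth n).contDiffAt) ((ψ.smooth n).contDiffAt), smul_add]
    rfl
  map_smul' c φ := by
    ext1 y
    change ‖y‖ ^ k • iteratedFDeriv ℝ n (c • ⇑φ) y = c • (‖y‖ ^ k • iteratedFDeriv ℝ n φ y)
    rw [iteratedFDeriv_const_smul_apply ((φ.smooth n).contDiffAt), smul_comm]

theorem weightedDeriv_apply (k n : ℕ) (φ : 𝓢(V, ℂ)) (y : V) :
    weightedDeriv k n φ y = ‖y‖ ^ k • iteratedFDeriv ℝ n φ y := rfl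

theorem norm_weightedDeriv_le (k n : ℕ) (φ : 𝓢(V, ℂ)) :
    ‖weightedDeriv k n φ‖ ≤ SchwartzMap.seminorm ℝ k n φ :=
  BoundedContinuousFunction.norm_ofNormedAddCommGroup_le _ (apply_nonneg _ _)
    (le_seminorm_weighted k n φ)

theorem seminorm_le_norm_weightedDeriv (k n : ℕ) (φ : 𝓢(V, ℂ)) :
    SchwartzMap.seminorm ℂ k n φ ≤ ‖weightedDeriv k n φ‖ := by
  refine seminorm_le_bound ℂ k n φ (norm_nonneg _) fun y => ?_
  have := (weightedDeriv k n φ).norm_coe_le_norm y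
  rwa [weightedDeriv_apply, norm_smul, norm_pow, norm_norm] at this

theorem continuous_weightedDeriv (k n : ℕ) :
    Continuous (weightedDeriv (V := V) k n) := by
  refine WithSeminorms.continuous_of_isBounded (schwartz_withSeminorms ℂ V ℂ)
    (norm_withSeminorms ℂ (BoundedForms V n)) _ fun _ => ⟨{(k, n)}, 1, fun φ => ?_⟩
  have h : ‖weightedDeriv k n φ‖ ≤ SchwartzMap.seminorm ℂ k n φ := norm_weightedDeriv_le k n φ
  simpa using h

/-- Evaluation at a point is continuous for the sup norm, so the Bochner integral can be computed
pointwise, where differentiation under the integral applies. -/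
theorem integral_weightedDeriv (k n : ℕ) {G : Z → 𝓢(V, ℂ)} (hG : Continuous G)
    (hint : ∀ k m, Integrable (fun z => SchwartzMap.seminorm ℝ k m (G z)) μ)
    {Φ : 𝓢(V, ℂ)} (hΦ : ∀ y, Φ y = ∫ z, G z y ∂μ) :
    Integrable (fun z => weightedDeriv k n (G z)) μ ∧
      ∫ z, weightedDeriv k n (G z) ∂μ = weightedDeriv k n Φ := by
  have hI : Integrable (fun z => weightedDeriv k n (G z)) μ :=
    (hint k n).mono' ((continuous_weightedDeriv k n).comp hG).aestronglyMeasurable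
      (Eventually.of_forall fun z => norm_weightedDeriv_le k n (G z))
  refine ⟨hI, ?_⟩
  ext1 y
  have h1 := (BoundedContinuousFunction.evalCLM ℝ y).integral_comp_comm hI
  simp only [BoundedContinuousFunction.evalCLM_apply] at h1
  rw [← h1, weightedDeriv_apply, funext hΦ, iteratedFDeriv_integral_schwartz n G hG (hint 0) y]
  simp only [weightedDeriv_apply]
  exact integral_smul _ _

/-- A tempered distribution commutes with the integral of a continuous family of Schwartz
functions all of whose seminorms are integrable. -/
theorem temperedDistribution_integral (u : 𝓢'(V, ℂ)) {G : Z → 𝓢(V, ℂ)} (hG : Continuous G)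
    (hint : ∀ k m, Integrable (fun z => SchwartzMap.seminorm ℝ k m (G z)) μ)
    {Φ : 𝓢(V, ℂ)} (hΦ : ∀ y, Φ y = ∫ z, G z y ∂μ) :
    Integrable (fun z => u (G z)) μ ∧ u Φ = ∫ z, u (G z) ∂μ := by
  -- Finitely many seminorms control `u`, so `u` factors through a finite product of Banach spaces,
  -- where Bochner integrals commute with continuous functionals.
  obtain ⟨s, C, -, hC⟩ := Seminorm.bound_of_continuous (schwartz_withSeminorms ℂ V ℂ)
    ((normSeminorm ℂ ℂ).comp (u : 𝓢(V, ℂ) →ₗ[ℂ] ℂ))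
    (continuous_norm.comp (map_continuous u))
  -- The index `(0, 0)` is added so that `ι` remembers the values of `φ` and is injective.
  let s' : Finset (ℕ × ℕ) := insert (0, 0) s
  let ι : 𝓢(V, ℂ) →ₗ[ℂ]
      ((i : s') → BoundedForms V i.1.2) :=
    LinearMap.pi fun i => weightedDeriv i.1.1 i.1.2
  have hιnorm : ∀ φ, ‖u φ‖ ≤ C * ‖ι φ‖ := by
    intro φ
    refine (hC φ).trans ?_
    change C * (s.sup (schwartzSeminormFamily ℂ V ℂ)) φ ≤ _
    gcongr
    refine Seminorm.finset_sup_apply_le (norm_nonneg _) fun i hi => ?_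
    exact (seminorm_le_norm_weightedDeriv i.1 i.2 φ).trans
      (norm_le_pi_norm (ι φ) ⟨i, Finset.mem_insert_of_mem hi⟩)
  have hinj : Function.Injective ι := by
    intro φ ψ h
    have h0 := congrFun h ⟨(0, 0), Finset.mem_insert_self _ _⟩
    ext y
    have h1 := congrArg (fun f => (f y) 0) h0
    simpa [ι, weightedDeriv_apply] using h1
  let e := LinearEquiv.ofInjective ι hinj
  let v : StrongDual ℂ (LinearMap.range ι) :=
    LinearMap.mkContinuous ((u : 𝓢(V, ℂ) →ₗ[ℂ] ℂ) ∘ₗ e.symm.toLinearMap) C fun x => by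
      have h := hιnorm (e.symm x)
      have h2 : ι (e.symm x) = x := congrArg Subtype.val (e.apply_symm_apply x)
      rw [h2] at h
      exact h
  -- Hahn–Banach: the functional induced on the range of `ι` extends to the whole product.
  obtain ⟨w, hw, -⟩ := exists_extension_norm_eq _ v
  have hwι : ∀ φ, w (ι φ) = u φ := by
    intro φ
    have h1 := hw (e φ)
    change w (ι φ) = u (e.symm (e φ)) at h1
    rw [h1, e.symm_apply_apply]
  have hI : Integrable (fun z => ι (G z)) μ :=
    Integrable.of_eval fun i => (integral_weightedDeriv i.1.1 i.1.2 hG hint hΦ).1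
  have hval : ∫ z, ι (G z) ∂μ = ι Φ := by
    funext i
    rw [eval_integral]
    · exact (integral_weightedDeriv i.1.1 i.1.2 hG hint hΦ).2
    · exact fun i => (integral_weightedDeriv i.1.1 i.1.2 hG hint hΦ).1
  have hkey := w.integral_comp_comm hI
  have hI2 := w.integrable_comp hI
  simp only [hwι, hval] at hkey hI2
  exact ⟨hI2, hkey.symm⟩

end SchwartzIntegral

/-! ### Modulations and translations of Schwartz functions -/

section Modulation

variable {d : ℕ}

/-- The modulation `y ↦ exp (2πi ω · y) ψ y` of a Schwartz function. -/
def modulate (ω : Rd d) : 𝓢(Rd d, ℂ) →L[ℂ] 𝓢(Rd d, ℂ) :=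
  SchwartzMap.smulLeftCLM ℂ (planeWave (2 * Real.pi)⁻¹ ω)

/-- The translation `y ↦ ψ (y - x)` of a Schwartz function. -/
abbrev translate (x : Rd d) : 𝓢(Rd d, ℂ) →L[ℂ] 𝓢(Rd d, ℂ) :=
  SchwartzMap.compSubConstCLM ℂ x

/-- The product of two Schwartz functions. -/
def mulS (φ : 𝓢(Rd d, ℂ)) : 𝓢(Rd d, ℂ) →L[ℂ] 𝓢(Rd d, ℂ) :=
  SchwartzMap.smulLeftCLM ℂ φ

@[simp]
theorem mulS_apply (φ ψ : 𝓢(Rd d, ℂ)) (y : Rd d) : mulS φ ψ y = φ y * ψ y := by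
  simp [mulS, SchwartzMap.smulLeftCLM_apply_apply φ.hasTemperateGrowth]

/-- The phase of the unit plane wave, as a linear functional. -/
def phase (ω : Rd d) : Rd d →L[ℝ] ℝ := (2 * Real.pi) • innerSL ℝ ω

theorem phase_apply (ω y : Rd d) : phase ω y = 2 * Real.pi * inner ℝ ω y := by
  simp [phase]

theorem norm_phase (ω : Rd d) : ‖phase ω‖ = 2 * Real.pi * ‖ω‖ := by
  rw [phase, norm_smul, innerSL_apply_norm, Real.norm_of_nonneg (by positivity)]

theorem planeWave_unit (ω y : Rd d) :
    planeWave (2 * Real.pi)⁻¹ ω y = Complex.exp (Complex.I * (phase ω y : ℝ)) := by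
  rw [planeWave, phase_apply]
  push_cast
  congr 1
  simp [div_eq_mul_inv]
  ring

@[simp]
theorem modulate_apply (ω y : Rd d) (ψ : 𝓢(Rd d, ℂ)) :
    modulate ω ψ y = Real.fourierChar (inner ℝ ω y) * ψ y := by
  rw [modulate, SchwartzMap.smulLeftCLM_apply_apply (hasTemperateGrowth_planeWave _ ω),
    smul_eq_mul, planeWave_unit, phase_apply, Real.fourierChar_apply, mul_comm Complex.I]

theorem modulate_zero (ψ : 𝓢(Rd d, ℂ)) : modulate 0 ψ = ψ := by
  ext y; simp

theorem modulate_modulate (ω ν : Rd d) (ψ : 𝓢(Rd d, ℂ)) :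
    modulate ω (modulate ν ψ) = modulate (ω + ν) ψ := by
  ext y
  simp only [modulate_apply, inner_add_left, AddChar.map_add_eq_mul, Circle.coe_mul]
  ring

/-- All derivatives of `t ↦ exp (i t)` are unimodular, so composing with the linear functional
`phase ω` costs one factor `‖phase ω‖` per derivative. -/
theorem norm_iteratedFDeriv_cexp_phase_le (ω : Rd d) (n : ℕ) (y : Rd d) :
    ‖iteratedFDeriv ℝ n (fun y => Complex.exp (Complex.I * (phase ω y : ℝ))) y‖ ≤ ‖phase ω‖ ^ n := by
  have hs : ContDiff ℝ n (fun t : ℝ => Complex.exp (Complex.I * (t : ℂ))) :=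
    (contDiff_const.mul Complex.ofRealCLM.contDiff).cexp
  have hd : ∀ n : ℕ, iteratedDeriv n (fun t : ℝ => Complex.exp (Complex.I * (t : ℂ)))
      = fun t : ℝ => Complex.I ^ n * Complex.exp (Complex.I * (t : ℂ)) := by
    intro n
    induction n with
    | zero => simp
    | succ n ih =>
      rw [iteratedDeriv_succ, ih]
      funext t
      have h1 : HasDerivAt (fun t : ℝ => Complex.I * (t : ℂ)) (Complex.I * 1) t :=
        (Complex.ofRealCLM.hasDerivAt (x := t)).const_mul Complex.I
      rw [((h1.cexp).const_mul (Complex.I ^ n)).deriv]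
      ring
  have h := (phase ω).iteratedFDeriv_comp_right hs y (i := n) le_rfl
  change ‖iteratedFDeriv ℝ n ((fun t : ℝ => Complex.exp (Complex.I * (t : ℂ))) ∘ phase ω) y‖ ≤ _
  rw [h]
  refine (ContinuousMultilinearMap.norm_compContinuousLinearMap_le _ _).trans ?_
  rw [norm_iteratedFDeriv_eq_norm_iteratedDeriv, hd, norm_mul, norm_pow, Complex.norm_I, one_pow,
    mul_comm Complex.I, Complex.norm_exp_ofReal_mul_I]
  simp

theorem contDiff_cexp_phase (ω : Rd d) (n : ℕ) :
    ContDiff ℝ n (fun y => Complex.exp (Complex.I * (phase ω y : ℝ))) :=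
  (contDiff_const.mul (Complex.ofRealCLM.contDiff.comp (phase ω).contDiff)).cexp

/-- Leibniz rule with a constant independent of `f`. The linear growth allowed by `1 + ‖y‖` is paid
for with the seminorms of weight `k + 1`; it is needed for `exp (i phase) - 1`. -/
theorem seminorm_mul_le (k n : ℕ) (ψ : 𝓢(Rd d, ℂ)) : ∃ K : ℝ, 0 ≤ K ∧
    ∀ (f : Rd d → ℂ) (A : ℝ) (φ : 𝓢(Rd d, ℂ)), ContDiff ℝ n f → 0 ≤ A →
      (∀ i ≤ n, ∀ y, ‖iteratedFDeriv ℝ i f y‖ ≤ A * (1 + ‖y‖)) → (∀ y, φ y = f y * ψ y) →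
      SchwartzMap.seminorm ℝ k n φ ≤ A * K := by
  refine ⟨∑ i ∈ Finset.range (n + 1), (n.choose i : ℝ) * (SchwartzMap.seminorm ℝ k (n - i) ψ +
    SchwartzMap.seminorm ℝ (k + 1) (n - i) ψ), by positivity, fun f A φ hf hA hfA hφ => ?_⟩
  refine seminorm_le_bound ℝ k n φ (by positivity) fun y => ?_
  have hφ' : ⇑φ = fun y => f y * ψ y := funext hφ
  rw [hφ']
  have h1 := norm_iteratedFDeriv_mul_le (N := n) hf (ψ.smooth n) y (n := n) le_rfl
  calc ‖y‖ ^ k * _ ≤ ‖y‖ ^ k * _ := mul_le_mul_of_nonneg_left h1 (by positivity)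
    _ ≤ _ := by
      rw [Finset.mul_sum, Finset.mul_sum]
      refine Finset.sum_le_sum fun i hi => ?_
      have h2 := hfA i (by simpa [Nat.lt_succ_iff] using hi) y
      have h3 := le_seminorm ℝ k (n - i) ψ y
      have h4 := le_seminorm ℝ (k + 1) (n - i) ψ y
      calc ‖y‖ ^ k * ((n.choose i : ℝ) * ‖iteratedFDeriv ℝ i f y‖ * ‖iteratedFDeriv ℝ (n - i) ψ y‖)
          ≤ ‖y‖ ^ k * ((n.choose i : ℝ) * (A * (1 + ‖y‖)) * ‖iteratedFDeriv ℝ (n - i) ψ y‖) := by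
            gcongr
        _ = A * ((n.choose i : ℝ) * (‖y‖ ^ k * ‖iteratedFDeriv ℝ (n - i) ψ y‖ +
              ‖y‖ ^ (k + 1) * ‖iteratedFDeriv ℝ (n - i) ψ y‖)) := by ring
        _ ≤ _ := by gcongr

theorem modulate_apply' (ω y : Rd d) (ψ : 𝓢(Rd d, ℂ)) :
    modulate ω ψ y = Complex.exp (Complex.I * (phase ω y : ℝ)) * ψ y := by
  rw [modulate_apply, Real.fourierChar_apply, phase_apply, mul_comm Complex.I]

theorem seminorm_modulate_le (k n : ℕ) (ψ : 𝓢(Rd d, ℂ)) : ∃ K : ℝ, 0 ≤ K ∧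
    ∀ ω : Rd d, SchwartzMap.seminorm ℝ k n (modulate ω ψ) ≤ (1 + 2 * Real.pi * ‖ω‖) ^ n * K := by
  obtain ⟨K, hK, h⟩ := seminorm_mul_le k n ψ
  refine ⟨K, hK, fun ω => h _ _ _ (contDiff_cexp_phase ω n) (by positivity) (fun i hi y => ?_)
    (fun y => modulate_apply' ω y ψ)⟩
  refine (norm_iteratedFDeriv_cexp_phase_le ω i y).trans ?_
  rw [norm_phase]
  have h1 : 0 ≤ 2 * Real.pi * ‖ω‖ := by positivity
  calc (2 * Real.pi * ‖ω‖) ^ i ≤ (1 + 2 * Real.pi * ‖ω‖) ^ i := by gcongr; linarith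
    _ ≤ (1 + 2 * Real.pi * ‖ω‖) ^ n := by gcongr; linarith
    _ ≤ _ := le_mul_of_one_le_right (by positivity) (by linarith [norm_nonneg y])

/-- At order zero `|exp (i t) - 1| ≤ |t|`; at order `i ≥ 1` the bound `‖phase ω‖ ^ i` is at most
`‖phase ω‖` because `‖phase ω‖ ≤ 1`. -/
theorem seminorm_modulate_sub_le (k n : ℕ) (ψ : 𝓢(Rd d, ℂ)) : ∃ K : ℝ, 0 ≤ K ∧
    ∀ ω : Rd d, ‖phase ω‖ ≤ 1 →
      SchwartzMap.seminorm ℝ k n (modulate ω ψ - ψ) ≤ ‖phase ω‖ * K := by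
  obtain ⟨K, hK, h⟩ := seminorm_mul_le k n ψ
  refine ⟨K, hK, fun ω hω => h (fun y => Complex.exp (Complex.I * (phase ω y : ℝ)) - 1) _ _
    ((contDiff_cexp_phase ω n).sub contDiff_const) (by positivity) (fun i hi y => ?_)
    (fun y => ?_)⟩
  · rcases Nat.eq_zero_or_pos i with rfl | hi0
    · rw [norm_iteratedFDeriv_zero]
      have h1 := Real.norm_exp_I_mul_ofReal_sub_one_le (x := phase ω y)
      refine h1.trans (((phase ω).le_opNorm y).trans ?_)
      gcongr
      linarith
    · have h1 : iteratedFDeriv ℝ i (fun y => Complex.exp (Complex.I * (phase ω y : ℝ)) - 1) y =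
          iteratedFDeriv ℝ i (fun y => Complex.exp (Complex.I * (phase ω y : ℝ))) y := by
        have h2 := iteratedFDeriv_sub_apply (𝕜 := ℝ) (i := i) (x := y)
          (f := fun y => Complex.exp (Complex.I * (phase ω y : ℝ))) (g := fun _ => (1 : ℂ))
          (contDiff_cexp_phase ω i).contDiffAt contDiff_const.contDiffAt
        rw [iteratedFDeriv_const_of_ne hi0.ne'] at h2
        rw [Pi.zero_apply, sub_zero] at h2
        exact h2
      rw [h1]
      refine (norm_iteratedFDeriv_cexp_phase_le ω i y).trans ?_
      calc ‖phase ω‖ ^ i ≤ ‖phase ω‖ ^ 1 := pow_le_pow_of_le_one (norm_nonneg _) hω hi0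
        _ ≤ _ := by
          rw [pow_one]
          exact le_mul_of_one_le_right (norm_nonneg _) (by linarith [norm_nonneg y])
  · rw [sub_apply, modulate_apply']
    ring

/-- Continuity at `ω = 0` is the preceding estimate; the group law `modulate_modulate` carries it to
every `ω₀`. -/
theorem continuous_modulate (ψ : 𝓢(Rd d, ℂ)) : Continuous fun ω : Rd d => modulate ω ψ := by
  have key : ∀ ψ : 𝓢(Rd d, ℂ), Tendsto (fun ω : Rd d => modulate ω ψ) (𝓝 0) (𝓝 ψ) := by
    intro ψ
    rw [(schwartz_withSeminorms ℝ (Rd d) ℂ).tendsto_nhds]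
    rintro ⟨k, n⟩ ε hε
    obtain ⟨K, hK, h⟩ := seminorm_modulate_sub_le k n ψ
    have hc : Tendsto (fun ω : Rd d => ‖phase ω‖) (𝓝 0) (𝓝 0) := by
      have : Continuous fun ω : Rd d => ‖phase ω‖ := by simp only [norm_phase]; fun_prop
      simpa [norm_phase] using this.tendsto 0
    have hc2 : Tendsto (fun ω : Rd d => ‖phase ω‖ * K) (𝓝 0) (𝓝 0) := by
      simpa using hc.mul_const K
    filter_upwards [hc.eventually_le_const one_pos, hc2.eventually_lt_const hε] with ω h1 h2
    exact (h ω h1).trans_lt h2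
  rw [continuous_iff_continuousAt]
  intro ω₀
  have h1 : Tendsto (fun ω : Rd d => ω - ω₀) (𝓝 ω₀) (𝓝 0) := by
    simpa using (continuous_sub_right ω₀).tendsto ω₀
  refine ((key (modulate ω₀ ψ)).comp h1).congr fun ω => ?_
  simp [modulate_modulate]

theorem fourierInv_modulate_fourier (x : Rd d) (ψ : 𝓢(Rd d, ℂ)) :
    𝓕⁻ (modulate (-x) (𝓕 ψ)) = translate x ψ := by
  ext y
  have h : 𝓕⁻ (𝓕 ψ) (y - x) = ψ (y - x) := by rw [FourierTransform.fourierInv_fourier_eq]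
  rw [compSubConstCLM_apply, ← h, fourierInv_coe, fourierInv_coe, Real.fourierInv_eq,
    Real.fourierInv_eq]
  refine integral_congr_ae (Eventually.of_forall fun ω => ?_)
  simp only [modulate_apply, Circle.smul_def, smul_eq_mul, ← mul_assoc, ← Circle.coe_mul,
    ← AddChar.map_add_eq_mul]
  congr 4
  rw [inner_sub_right, inner_neg_left, real_inner_comm x]
  ring

theorem fourier_translate (x : Rd d) (ψ : 𝓢(Rd d, ℂ)) :
    𝓕 (translate x ψ) = modulate (-x) (𝓕 ψ) := by
  rw [← fourierInv_modulate_fourier, FourierTransform.fourier_fourierInv_eq]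

/-- Translations are conjugate to modulations under the Fourier transform, which is continuous on
Schwartz space. -/
theorem continuous_translate (ψ : 𝓢(Rd d, ℂ)) : Continuous fun x : Rd d => translate x ψ := by
  simp only [← fourierInv_modulate_fourier]
  exact (ContinuousFourierInv.continuous_fourierInv).comp
    ((continuous_modulate _).comp continuous_neg)

/-- A tempered distribution on a product of Schwartz functions, by expanding one factor into plane
waves. -/
theorem temperedDistribution_mul (u : 𝓢'(Rd d, ℂ)) (φ ψ : 𝓢(Rd d, ℂ)) :
    Integrable (fun ω => 𝓕 φ ω * u (modulate ω ψ)) ∧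
      u (mulS φ ψ) = ∫ ω, 𝓕 φ ω * u (modulate ω ψ) := by
  have h := temperedDistribution_integral (μ := (volume : Measure (Rd d))) u
    (G := fun ω => 𝓕 φ ω • modulate ω ψ) (Φ := mulS φ ψ)
    ((𝓕 φ).continuous.smul (continuous_modulate ψ)) ?_ ?_
  · simpa using h
  · intro k n
    -- The seminorms of `modulate ω ψ` grow polynomially in `ω`, which the rapid decay of `𝓕 φ`
    -- absorbs.
    obtain ⟨K, hK, h⟩ := seminorm_modulate_le k n ψ
    have hI : Integrable (fun ω : Rd d => (2 * Real.pi) ^ n * 2 ^ (n - 1) * K *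
        (‖𝓕 φ ω‖ + ‖ω‖ ^ n * ‖𝓕 φ ω‖)) :=
      (((𝓕 φ).integrable.norm).add ((𝓕 φ).integrable_pow_mul volume n)).const_mul _
    refine hI.mono' ((continuous_seminorm_schwartz k n).comp
      ((𝓕 φ).continuous.smul (continuous_modulate ψ))).aestronglyMeasurable
      (Eventually.of_forall fun ω => ?_)
    rw [Real.norm_of_nonneg (apply_nonneg _ _)]
    have h1 : SchwartzMap.seminorm ℝ k n (𝓕 φ ω • modulate ω ψ) =
        ‖𝓕 φ ω‖ * SchwartzMap.seminorm ℝ k n (modulate ω ψ) :=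
      map_smul_eq_mul (SchwartzMap.seminorm ℂ k n) _ _
    rw [h1]
    have h2 : (1 + 2 * Real.pi * ‖ω‖) ^ n ≤ (2 * Real.pi) ^ n * 2 ^ (n - 1) * (1 + ‖ω‖ ^ n) := by
      have h3 : 1 + 2 * Real.pi * ‖ω‖ ≤ 2 * Real.pi * (1 + ‖ω‖) := by
        nlinarith [Real.pi_gt_three]
      calc (1 + 2 * Real.pi * ‖ω‖) ^ n ≤ (2 * Real.pi * (1 + ‖ω‖)) ^ n := by gcongr
        _ = (2 * Real.pi) ^ n * (1 + ‖ω‖) ^ n := mul_pow _ _ _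
        _ ≤ (2 * Real.pi) ^ n * (2 ^ (n - 1) * (1 ^ n + ‖ω‖ ^ n)) := by
          gcongr
          exact add_pow_le zero_le_one (norm_nonneg _) n
        _ = _ := by rw [one_pow]; ring
    calc ‖𝓕 φ ω‖ * SchwartzMap.seminorm ℝ k n (modulate ω ψ)
        ≤ ‖𝓕 φ ω‖ * (((2 * Real.pi) ^ n * 2 ^ (n - 1) * (1 + ‖ω‖ ^ n)) * K) := by
          gcongr
          exact (h ω).trans (by gcongr)
      _ = _ := by ring
  · intro y
    rw [mulS_apply]
    have h : 𝓕⁻ (𝓕 φ) y = φ y := by rw [FourierTransform.fourierInv_fourier_eq]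
    rw [← h, fourierInv_coe, Real.fourierInv_eq, ← integral_mul_const]
    refine integral_congr_ae (Eventually.of_forall fun ω => ?_)
    simp only [smul_apply, modulate_apply, Circle.smul_def, smul_eq_mul]
    ring

end Modulation

/-! ### Polynomial weights -/

section Weights

variable {d : ℕ}

/-- The weight `(1 + ‖x‖) ^ (-N)`. -/
def weight (N : ℕ) (x : Rd d) : ℝ := ((1 + ‖x‖) ^ N)⁻¹

theorem weight_pos (N : ℕ) (x : Rd d) : 0 < weight N x := by
  unfold weight; positivity

theorem weight_le_one (N : ℕ) (x : Rd d) : weight N x ≤ 1 :=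
  inv_le_one_of_one_le₀ (one_le_pow₀ (by linarith [norm_nonneg x]))

theorem continuous_weight (N : ℕ) : Continuous (weight (d := d) N) := by
  unfold weight
  exact Continuous.inv₀ (by fun_prop) fun x => by positivity

theorem weight_add (N M : ℕ) (x : Rd d) : weight (N + M) x = weight N x * weight M x := by
  rw [weight, weight, weight, pow_add, mul_inv]

theorem weight_neg (N : ℕ) (x : Rd d) : weight N (-x) = weight N x := by
  rw [weight, weight, norm_neg]

theorem weight_mul_le (N : ℕ) {x y z : Rd d} (h : ‖x‖ ≤ ‖y‖ + ‖z‖) :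
    weight N y * weight N z ≤ weight N x := by
  rw [weight, weight, weight, ← mul_inv, ← mul_pow]
  gcongr
  nlinarith [norm_nonneg y, norm_nonneg z]

theorem integrable_weight : Integrable (weight (d := d) (d + 1)) := by
  have h := integrable_one_add_norm (E := Rd d) (μ := volume) (r := ((d + 1 : ℕ) : ℝ))
    (by simp)
  refine h.congr (Eventually.of_forall fun x => ?_)
  simp only [weight]
  rw [Real.rpow_neg (by positivity), Real.rpow_natCast]

theorem exists_norm_le_weight (φ : 𝓢(Rd d, ℂ)) (N : ℕ) :
    ∃ C : ℝ, 0 ≤ C ∧ ∀ x, ‖φ x‖ ≤ C * weight N x := by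
  refine ⟨2 ^ N * ((Finset.Iic (N, 0)).sup fun m => SchwartzMap.seminorm ℝ m.1 m.2) φ,
    mul_nonneg (by positivity) (apply_nonneg _ _), fun x => ?_⟩
  have h := one_add_le_sup_seminorm_apply (𝕜 := ℝ) (m := (N, 0)) (k := N) (n := 0) le_rfl le_rfl φ x
  rw [norm_iteratedFDeriv_zero] at h
  rw [weight, ← div_eq_mul_inv, le_div_iff₀ (by positivity), mul_comm]
  exact h

/-- Rapid decay of the correlation of two Schwartz functions, uniformly under contractions. -/
theorem exists_integral_mul_le_weight (γ η : 𝓢(Rd d, ℂ)) (N : ℕ) :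
    ∃ C : ℝ, 0 ≤ C ∧ ∀ (ε : ℝ) (s : Rd d), |ε| ≤ 1 →
      ∫ y, ‖γ y‖ * ‖η (ε • y + s)‖ ≤ C * weight N s := by
  obtain ⟨A, hA, hγ⟩ := exists_norm_le_weight γ (N + (d + 1))
  obtain ⟨B, hB, hη⟩ := exists_norm_le_weight η N
  refine ⟨A * B * ∫ y : Rd d, weight (d + 1) y,
    mul_nonneg (by positivity) (integral_nonneg fun y => (weight_pos _ y).le), fun ε s hε => ?_⟩
  -- Of the decay of `γ`, order `N` is spent on transferring the decay of `η` to `s`, and order `d +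
  -- 1` makes the integral over `y` converge.
  have h1 : ∀ y, ‖γ y‖ * ‖η (ε • y + s)‖ ≤ A * B * weight N s * weight (d + 1) y := by
    intro y
    have h2 : weight N y * weight N (ε • y + s) ≤ weight N s := by
      refine weight_mul_le N ?_
      calc ‖s‖ = ‖(ε • y + s) - ε • y‖ := by rw [add_sub_cancel_left]
        _ ≤ ‖ε • y + s‖ + ‖ε • y‖ := norm_sub_le _ _
        _ ≤ ‖ε • y + s‖ + 1 * ‖y‖ := by
          rw [norm_smul, Real.norm_eq_abs]
          gcongr
        _ = _ := by ring
    calc ‖γ y‖ * ‖η (ε • y + s)‖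
        ≤ (A * weight (N + (d + 1)) y) * (B * weight N (ε • y + s)) := by
          gcongr
          · exact mul_nonneg hA (weight_pos _ _).le
          · exact hγ y
          · exact hη _
      _ = A * B * (weight N y * weight N (ε • y + s)) * weight (d + 1) y := by
          rw [weight_add]; ring
      _ ≤ _ := by
          gcongr
          exact (weight_pos _ _).le
  have hI : Integrable fun y : Rd d => A * B * weight N s * weight (d + 1) y :=
    integrable_weight.const_mul _
  calc ∫ y, ‖γ y‖ * ‖η (ε • y + s)‖ ≤ ∫ y : Rd d, A * B * weight N s * weight (d + 1) y := by
        refine integral_mono (hI.mono' ?_ (Eventually.of_forall fun y => ?_)) hI h1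
        · have := η.continuous
          have := γ.continuous
          exact Continuous.aestronglyMeasurable (by fun_prop)
        · rw [Real.norm_of_nonneg (by positivity)]
          exact h1 y
    _ = _ := by rw [integral_const_mul]; ring

end Weights

/-! ### Distributions in the Sjöstrand class are bounded continuous functions -/

section Representation

variable {d : ℕ}

theorem integral_fourier_mul_eq_integral_mul_fourier {f g : Rd d → ℂ} (hf : Integrable f)
    (hg : Integrable g) : ∫ ω, 𝓕 f ω * g ω = ∫ y, f y * 𝓕 g y := by
  simpa using! VectorFourier.integral_bilin_fourierIntegral_eq_flip (ContinuousLinearMap.mul ℂ ℂ)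
    (L := innerₗ (Rd d)) Real.continuous_fourierChar continuous_inner hf hg

theorem norm_fourier_le_integral (f : Rd d → ℂ) (ω : Rd d) : ‖𝓕 f ω‖ ≤ ∫ y, ‖f y‖ :=
  VectorFourier.norm_fourierIntegral_le_integral_norm _ _ _ _ _

theorem continuous_fourier_of_integrable {f : Rd d → ℂ} (hf : Integrable f) : Continuous (𝓕 f) :=
  VectorFourier.fourierIntegral_continuous Real.continuous_fourierChar continuous_inner hf

theorem stronglyMeasurable_uncurry_swap {H : Rd d → Rd d → ℂ}
    (h : StronglyMeasurable (Function.uncurry H)) :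
    StronglyMeasurable (Function.uncurry fun x y => H y x) :=
  h.comp_measurable measurable_swap

theorem stronglyMeasurable_fourier_apply {b : Rd d → Rd d → ℂ}
    (hb : StronglyMeasurable (Function.uncurry b)) (y : Rd d) :
    StronglyMeasurable fun x : Rd d => 𝓕 (b x) y := by
  simp only [Real.fourier_eq]
  have h3 : Continuous fun p : Rd d × Rd d => (Real.fourierChar (-inner ℝ p.2 y) : ℂ) :=
    continuous_induced_dom.comp (Real.continuous_fourierChar.comp (by fun_prop))
  have h4 : StronglyMeasurable fun p : Rd d × Rd d =>
      Real.fourierChar (-inner ℝ p.2 y) • b p.1 p.2 := h3.stronglyMeasurable.mul hb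
  exact h4.integral_prod_right'

/-- Continuity in `y` together with measurability in `x` gives joint measurability (Carathéodory).
-/
theorem stronglyMeasurable_uncurry_fourier {b : Rd d → Rd d → ℂ}
    (hb : StronglyMeasurable (Function.uncurry b)) (hi : ∀ x, Integrable (b x)) :
    StronglyMeasurable (Function.uncurry fun x y : Rd d => 𝓕 (b x) y) :=
  stronglyMeasurable_uncurry_swap (H := fun y x => 𝓕 (b x) y)
    (stronglyMeasurable_uncurry_of_continuous_of_stronglyMeasurable
      (fun x => continuous_fourier_of_integrable (hi x))
      (fun y => stronglyMeasurable_fourier_apply hb y))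

theorem integrable_mul_comp_sub {f g : Rd d → ℂ} (hf : Integrable f) (hg : Integrable g) :
    Integrable fun p : Rd d × Rd d => f p.2 * g (p.2 - p.1) := by
  have h := Integrable.convolution_integrand (ContinuousLinearMap.mul ℝ ℂ) hf hg.comp_neg
  simpa using! h

theorem bracket_self_ne_zero {γ : 𝓢(Rd d, ℂ)} (hγ : γ ≠ 0) : bracket γ γ ≠ 0 := by
  have h1 : bracket γ γ = ((∫ y, ‖γ y‖ ^ 2 : ℝ) : ℂ) := by
    rw [bracket, ← integral_complex_ofReal]
    refine integral_congr_ae (Eventually.of_forall fun y => ?_)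
    simp only [Complex.mul_conj, Complex.normSq_eq_norm_sq]
  rw [h1, Ne, Complex.ofReal_eq_zero]
  intro h
  have hi : Integrable fun y => ‖γ y‖ ^ 2 := (γ.memLp 2).integrable_norm_pow (by norm_num)
  rw [integral_eq_zero_iff_of_nonneg (fun y => by positivity) hi] at h
  have hc : Continuous fun y => ‖γ y‖ ^ 2 := by
    have := γ.continuous
    fun_prop
  have h2 := (Continuous.ae_eq_iff_eq volume hc continuous_zero).1 h
  refine hγ (SchwartzMap.ext fun y => ?_)
  simpa using congrFun h2 y

/-- `u` is recovered from its localizations `θ (· - x) u`. -/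
theorem temperedDistribution_integral_translate (u : 𝓢'(Rd d, ℂ)) (φ θ : 𝓢(Rd d, ℂ))
    {B : Rd d → ℝ} (hB : Integrable B) (hle : ∀ x, ‖u (mulS φ (translate x θ))‖ ≤ B x) :
    Integrable (fun x => u (mulS φ (translate x θ))) ∧
      ∫ x, u (mulS φ (translate x θ)) = (∫ y, θ y) * u φ := by
  -- As a function of `x`, the localized pairing is the Fourier transform of `H`. Inversion at `0`
  -- turns its integral into `H 0 = (∫ θ) * u φ`; the bound `B` supplies the integrability that
  -- inversion requires.
  let H : Rd d → ℂ := fun ω => 𝓕 θ ω * u (modulate ω φ)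
  have hHc : Continuous H := (𝓕 θ).continuous.mul ((map_continuous u).comp (continuous_modulate φ))
  have hHi : Integrable H := (temperedDistribution_mul u θ φ).1
  have hF : ∀ x, u (mulS φ (translate x θ)) = 𝓕 H x := by
    intro x
    have h1 : mulS φ (translate x θ) = mulS (translate x θ) φ := by
      ext y; simp only [mulS_apply, mul_comm]
    rw [h1, (temperedDistribution_mul u (translate x θ) φ).2, Real.fourier_eq]
    refine integral_congr_ae (Eventually.of_forall fun ω => ?_)
    simp only [H, fourier_translate, modulate_apply, Circle.smul_def, smul_eq_mul, inner_neg_left,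
      real_inner_comm x]
    ring
  simp only [hF] at hle ⊢
  have hFI : Integrable (𝓕 H) := hB.mono' (continuous_fourier_of_integrable hHi).aestronglyMeasurable
    (Eventually.of_forall hle)
  refine ⟨hFI, ?_⟩
  have h := hHi.fourierInv_fourier_eq hFI (v := 0) hHc.continuousAt
  rw [Real.fourierInv_eq] at h
  simp only [inner_zero_right, AddChar.map_zero_eq_one, one_smul] at h
  rw [h]
  simp only [H, modulate_zero, fourier_coe, Real.fourier_eq, inner_zero_right, neg_zero,
    AddChar.map_zero_eq_one, one_smul]

/-- The supremum over all translations of the windowed Fourier transform of `u`. -/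
def windowSup (u : 𝓢'(Rd d, ℂ)) (γ : 𝓢(Rd d, ℂ)) (ω : Rd d) : ℝ≥0∞ :=
  ⨆ x : Rd d, ‖u (modulate ω (translate x γ))‖ₑ

section

variable {u : 𝓢'(Rd d, ℂ)} {γ : 𝓢(Rd d, ℂ)} (hu : ∫⁻ ω, windowSup u γ ω < ⊤)

include hu

theorem integrable_window (x : Rd d) : Integrable fun ω => u (modulate ω (translate x γ)) := by
  refine ⟨((map_continuous u).comp (continuous_modulate _)).aestronglyMeasurable, ?_⟩
  exact (lintegral_mono fun ω => le_iSup (fun x => ‖u (modulate ω (translate x γ))‖ₑ) x).trans_lt hu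

theorem norm_fourier_window_le (x y : Rd d) :
    ‖𝓕 (fun ω => u (modulate ω (translate x γ))) y‖ ≤ (∫⁻ ω, windowSup u γ ω).toReal := by
  refine (norm_fourier_le_integral _ y).trans ?_
  rw [integral_norm_eq_lintegral_enorm (integrable_window hu x).aestronglyMeasurable]
  exact ENNReal.toReal_mono hu.ne
    (lintegral_mono fun ω => le_iSup (fun x => ‖u (modulate ω (translate x γ))‖ₑ) x)

theorem stronglyMeasurable_fourier_window : StronglyMeasurable
    (Function.uncurry fun x y : Rd d => 𝓕 (fun ω => u (modulate ω (translate x γ))) y) :=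
  stronglyMeasurable_uncurry_fourier (b := fun x ω => u (modulate ω (translate x γ)))
    (stronglyMeasurable_uncurry_of_continuous_of_stronglyMeasurable
      (fun ω => (map_continuous u).comp ((modulate ω).continuous.comp (continuous_translate γ)))
      (fun x => ((map_continuous u).comp (continuous_modulate (translate x γ))).stronglyMeasurable))
    (integrable_window hu)

/-- Expanding `φ` into plane waves and moving the Fourier transform to the other factor shows that
the localization of `u` is a function. -/
theorem apply_mul_translate_eq_integral (φ : 𝓢(Rd d, ℂ)) (x : Rd d) :
    u (mulS φ (translate x γ)) =
      ∫ y, φ y * 𝓕 (fun ω => u (modulate ω (translate x γ))) y := by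
  rw [(temperedDistribution_mul u φ (translate x γ)).2]
  exact integral_fourier_mul_eq_integral_mul_fourier φ.integrable (integrable_window hu x)

/-- A tempered distribution whose windowed Fourier transform has an integrable supremum over
translations is given by a bounded continuous function. -/
theorem exists_boundedContinuous_isGivenBy (hγ : γ ≠ 0) :
    ∃ f : BoundedContinuousFunction (Rd d) ℂ, IsGivenBy u f := by
  obtain ⟨K, hK0, h, hK, hm, hcont, hmul⟩ : ∃ K : ℝ, 0 ≤ K ∧ ∃ h : Rd d → Rd d → ℂ,
      (∀ x y, ‖h x y‖ ≤ K) ∧ StronglyMeasurable (Function.uncurry h) ∧ (∀ x, Continuous (h x)) ∧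
      ∀ (φ : 𝓢(Rd d, ℂ)) x, u (mulS φ (translate x γ)) = ∫ y, φ y * h x y :=
    ⟨_, ENNReal.toReal_nonneg, _, norm_fourier_window_le hu, stronglyMeasurable_fourier_window hu,
      fun x => continuous_fourier_of_integrable (integrable_window hu x),
      apply_mul_translate_eq_integral hu⟩
  -- With this choice `c = ∫ |γ|²`, which is nonzero.
  set η : 𝓢(Rd d, ℂ) := conjS γ with hη
  set c : ℂ := ∫ y, mulS γ η y with hc
  have hc0 : c ≠ 0 := by
    have := bracket_self_ne_zero hγ
    simpa [bracket, hc, hη] using this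
  -- The localization at `x` is `h x`; weighting by `η (· - x)` and integrating over `x` glues these
  -- to `c u`, since the translates of `γ η` integrate to `c`.
  let F : Rd d → ℂ := fun y => ∫ x, η (y - x) * h x y
  have hηi : ∀ y, Integrable fun x => η (y - x) := fun y => η.integrable.comp_sub_left y
  have hFb : ∀ y, ‖F y‖ ≤ K * ∫ z, ‖η z‖ := by
    intro y
    calc ‖F y‖ ≤ ∫ x, K * ‖η (y - x)‖ := by
          refine norm_integral_le_of_norm_le ((hηi y).norm.const_mul K)
            (Eventually.of_forall fun x => ?_)
          rw [norm_mul, mul_comm]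
          gcongr
          exact hK x y
      _ = K * ∫ z, ‖η z‖ := by
          rw [integral_const_mul, integral_sub_left_eq_self (fun z => ‖η z‖) volume y]
  have hFc : Continuous F := by
    rw [continuous_iff_continuousAt]
    intro y₀
    obtain ⟨A, hA, hηA⟩ := exists_norm_le_weight η (d + 1)
    have hev : ∀ᶠ y in 𝓝 y₀, ‖y - y₀‖ < 1 := by
      have := Metric.ball_mem_nhds y₀ one_pos
      filter_upwards [this] with y hy
      rwa [Metric.mem_ball, dist_eq_norm] at hy
    refine continuousAt_of_dominated (bound := fun x => A * 2 ^ (d + 1) * weight (d + 1) (y₀ - x) * K)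
      ?_ ?_ ?_ ?_
    · refine Eventually.of_forall fun y => ?_
      have h1 : Continuous fun x => η (y - x) := η.continuous.comp (by fun_prop)
      refine h1.aestronglyMeasurable.mul ?_
      exact (hm.comp_measurable (g := fun x => (x, y)) (by fun_prop)).aestronglyMeasurable
    · filter_upwards [hev] with y hy
      refine Eventually.of_forall fun x => ?_
      rw [norm_mul]
      -- For `‖y - y₀‖ < 1` one has `1 + ‖y₀ - x‖ ≤ 2 (1 + ‖y - x‖)`, so one integrable majorant
      -- serves all `y` near `y₀`.
      have h1 : weight (d + 1) (y - x) ≤ 2 ^ (d + 1) * weight (d + 1) (y₀ - x) := by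
        have h2 : ‖y₀ - x‖ ≤ ‖y - x‖ + ‖y - y₀‖ := by
          calc ‖y₀ - x‖ = ‖(y - x) - (y - y₀)‖ := by congr 1; abel
            _ ≤ _ := norm_sub_le _ _
        rw [weight, weight, inv_eq_one_div, inv_eq_one_div, mul_one_div,
          div_le_div_iff₀ (by positivity) (by positivity), one_mul, ← mul_pow]
        gcongr
        linarith [norm_nonneg (y - x)]
      calc ‖η (y - x)‖ * ‖h x y‖ ≤ (A * weight (d + 1) (y - x)) * K := by
            gcongr
            · exact mul_nonneg hA (weight_pos _ _).le
            · exact hηA _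
            · exact hK x y
        _ ≤ (A * (2 ^ (d + 1) * weight (d + 1) (y₀ - x))) * K := by gcongr
        _ = _ := by ring
    · exact ((integrable_weight.comp_sub_left y₀).const_mul _).mul_const K
    · refine Eventually.of_forall fun x => ?_
      exact ((η.continuous.comp (continuous_id.sub continuous_const)).mul (hcont x)).continuousAt
  have hmain : ∀ φ : 𝓢(Rd d, ℂ), c * u φ = ∫ y, φ y * F y := by
    intro φ
    have h1 : ∀ x, u (mulS φ (translate x (mulS γ η))) = ∫ y, φ y * η (y - x) * h x y := by
      intro x
      -- The factor `η` is absorbed into the test function, leaving the window `γ` for which `h x`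
      -- is known.
      have h2 : mulS φ (translate x (mulS γ η)) = mulS (mulS φ (translate x η)) (translate x γ) := by
        ext y
        simp only [mulS_apply, compSubConstCLM_apply]
        ring
      rw [h2, hmul]
      simp only [mulS_apply, compSubConstCLM_apply]
    have hP := integrable_mul_comp_sub φ.integrable η.integrable
    have hle : ∀ x, ‖u (mulS φ (translate x (mulS γ η)))‖ ≤ K * ∫ y, ‖φ y * η (y - x)‖ := by
      intro x
      rw [h1, ← integral_const_mul]
      refine norm_integral_le_of_norm_le ?_ (Eventually.of_forall fun y => ?_)
      · have : Integrable fun y => mulS φ (translate x η) y := (mulS φ (translate x η)).integrable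
        simp only [mulS_apply, compSubConstCLM_apply] at this
        exact this.norm.const_mul K
      · rw [norm_mul _ (h x y), mul_comm]
        gcongr
        exact hK x y
    have h3 := (temperedDistribution_integral_translate u φ (mulS γ η)
      (hP.integral_norm_prod_left.const_mul K) hle).2
    rw [← h3]
    simp only [h1]
    have hI : Integrable (Function.uncurry fun x y : Rd d => φ y * η (y - x) * h x y)
        (volume.prod volume) := by
      refine (hP.norm.const_mul K).mono' (hP.aestronglyMeasurable.mul hm.aestronglyMeasurable)
        (Eventually.of_forall fun p => ?_)
      rw [Function.uncurry_def, norm_mul, mul_comm]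
      gcongr
      exact hK _ _
    rw [integral_integral_swap hI]
    refine integral_congr_ae (Eventually.of_forall fun y => ?_)
    simp only [F, mul_assoc]
    exact integral_const_mul _ _
  refine ⟨BoundedContinuousFunction.ofNormedAddCommGroup (fun y => c⁻¹ * F y)
    (continuous_const.mul hFc) (‖c⁻¹‖ * (K * ∫ z, ‖η z‖)) fun y => ?_, fun φ => ⟨?_, ?_⟩⟩
  · rw [norm_mul]
    gcongr
    exact hFb y
  · exact φ.integrable.mul_bdd (BoundedContinuousFunction.continuous _).aestronglyMeasurable
      (Eventually.of_forall fun y => BoundedContinuousFunction.norm_coe_le_norm _ y)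
  · have h1 : u φ = c⁻¹ * ∫ y, φ y * F y := by rw [← hmain, inv_mul_cancel_left₀ hc0]
    rw [h1, ← integral_const_mul]
    refine integral_congr_ae (Eventually.of_forall fun y => ?_)
    simp only [BoundedContinuousFunction.coe_ofNormedAddCommGroup]
    ring

end
end Representation

/-! ### The short-time Fourier transform of bounded continuous functions -/

section ShortTime

variable {d : ℕ}

/-- The short-time Fourier transform of a function `Ψ` with window `η`. -/
def stft (η : 𝓢(Rd d, ℂ)) (Ψ : Rd d → ℂ) (x ω : Rd d) : ℂ :=
  𝓕 (fun y => Ψ y * η (y - x)) ω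

theorem integrable_mul_window (η : 𝓢(Rd d, ℂ)) (Ψ : BoundedContinuousFunction (Rd d) ℂ)
    (x : Rd d) : Integrable fun y => Ψ y * η (y - x) :=
  (η.integrable.comp_sub_right x).bdd_mul Ψ.continuous.aestronglyMeasurable
    (Eventually.of_forall fun y => Ψ.norm_coe_le_norm y)

theorem continuous_stft (η : 𝓢(Rd d, ℂ)) (Ψ : BoundedContinuousFunction (Rd d) ℂ)
    (x : Rd d) : Continuous (stft η Ψ x) :=
  continuous_fourier_of_integrable (integrable_mul_window η Ψ x)

theorem stronglyMeasurable_stft (η : 𝓢(Rd d, ℂ)) (Ψ : BoundedContinuousFunction (Rd d) ℂ) :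
    StronglyMeasurable (Function.uncurry (stft η Ψ)) := by
  refine stronglyMeasurable_uncurry_fourier (b := fun x y => Ψ y * η (y - x)) ?_
    (integrable_mul_window η Ψ)
  refine Continuous.stronglyMeasurable ?_
  have h1 := Ψ.continuous
  have h2 := η.continuous
  rw [Function.uncurry_def]
  fun_prop

/-- The supremum of the short-time Fourier transform over all translations. -/
def stftSup (γ : 𝓢(Rd d, ℂ)) (f : Rd d → ℂ) (ω : Rd d) : ℝ≥0∞ := ⨆ x, ‖stft γ f x ω‖ₑ

theorem enorm_stft_le_stftSup (γ : 𝓢(Rd d, ℂ)) (f : Rd d → ℂ) (x ω : Rd d) :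
    ‖stft γ f x ω‖ₑ ≤ stftSup γ f ω := le_iSup (fun x => ‖stft γ f x ω‖ₑ) x

/-- The supremum is uncountable, but a supremum of continuous functions is lower semicontinuous. -/
theorem measurable_stftSup (γ : 𝓢(Rd d, ℂ)) (f : BoundedContinuousFunction (Rd d) ℂ) :
    Measurable (stftSup γ f) :=
  (lowerSemicontinuous_iSup fun x =>
    (continuous_enorm.comp (continuous_stft γ f x)).lowerSemicontinuous).measurable

theorem lintegral_neg_stftSup (γ : 𝓢(Rd d, ℂ)) (f : Rd d → ℂ) :
    ∫⁻ ω, stftSup γ f (-ω) = ∫⁻ ω, stftSup γ f ω :=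
  lintegral_neg_eq_self (stftSup γ f)

theorem integrable_stft {γ : 𝓢(Rd d, ℂ)} {f : BoundedContinuousFunction (Rd d) ℂ}
    (hf : ∫⁻ ω, stftSup γ f ω < ⊤) (x : Rd d) : Integrable (stft γ f x) :=
  ⟨(continuous_stft γ f x).aestronglyMeasurable,
    (lintegral_mono fun ω => enorm_stft_le_stftSup γ f x ω).trans_lt hf⟩

/-- The short-time Fourier transforms with respect to two windows are dual to each other. -/
theorem integral_stft_mul_stft {γ η : 𝓢(Rd d, ℂ)} {f Ψ : BoundedContinuousFunction (Rd d) ℂ}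
    (hf : ∫⁻ ω, stftSup γ f ω < ⊤) (hΨ : Integrable Ψ)
    (hint : Integrable fun z : Rd d × Rd d => stft η Ψ z.1 z.2 * stft γ f z.1 (-z.2)) :
    ∫ z : Rd d × Rd d, stft η Ψ z.1 z.2 * stft γ f z.1 (-z.2) =
      (∫ y, γ y * η y) * ∫ y, Ψ y * f y := by
  -- Parseval in `ω` for fixed `x`. The later integration over `x` acts only on `γ η`, producing the
  -- constant.
  have h1 : ∀ x, ∫ ω, stft η Ψ x ω * stft γ f x (-ω) =
      ∫ y, Ψ y * f y * mulS γ η (y - x) := by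
    intro x
    have hc : Continuous fun y => f y * γ (y - x) :=
      f.continuous.mul (γ.continuous.comp (continuous_sub_right x))
    have h2 : (fun ω => stft γ f x (-ω)) = 𝓕⁻ fun y => f y * γ (y - x) := by
      funext ω
      rw [Real.fourierInv_eq_fourier_neg]
      rfl
    have h3 : Integrable fun ω => stft γ f x (-ω) := (integrable_stft hf x).comp_neg
    have h4 := integral_fourier_mul_eq_integral_mul_fourier (integrable_mul_window η Ψ x) h3
    rw [h2, hc.fourier_fourierInv_eq (integrable_mul_window γ f x) (integrable_stft hf x)] at h4
    refine (Eq.trans ?_ h4).trans ?_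
    · rfl
    · refine integral_congr_ae (Eventually.of_forall fun y => ?_)
      simp only [mulS_apply]
      ring
  have hΨf : Integrable fun y => Ψ y * f y :=
    hΨ.mul_bdd f.continuous.aestronglyMeasurable (Eventually.of_forall fun y => f.norm_coe_le_norm y)
  have hP := integrable_mul_comp_sub hΨf (mulS γ η).integrable
  rw [Measure.volume_eq_prod, integral_prod _ hint]
  simp only [h1]
  rw [integral_integral_swap hP, ← integral_const_mul]
  refine integral_congr_ae (Eventually.of_forall fun y => ?_)
  simp only [integral_const_mul]
  rw [integral_sub_left_eq_self (fun z => mulS γ η z) volume y]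
  simp only [mulS_apply]
  ring

/-- Hölder for mixed norms, `L¹` against `L^∞` in `x`. The bound `k` may depend on `ω`, which the
change of window needs. -/
theorem lintegral_mul_stft_le {γ : 𝓢(Rd d, ℂ)} {f : BoundedContinuousFunction (Rd d) ℂ}
    {K : Rd d → Rd d → ℂ} (hK : StronglyMeasurable (Function.uncurry K)) {k : Rd d → ℝ≥0∞}
    (hk : ∀ ω, ∫⁻ x, ‖K x ω‖ₑ ≤ k ω) :
    ∫⁻ z : Rd d × Rd d, ‖K z.1 z.2 * stft γ f z.1 (-z.2)‖ₑ ≤ ∫⁻ ω, k ω * stftSup γ f (-ω) := by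
  have hm : StronglyMeasurable fun z : Rd d × Rd d => K z.1 z.2 * stft γ f z.1 (-z.2) := by
    refine hK.mul ?_
    exact (stronglyMeasurable_stft γ f).comp_measurable (g := fun z : Rd d × Rd d => (z.1, -z.2))
      (by fun_prop)
  rw [Measure.volume_eq_prod, lintegral_prod_symm _ hm.enorm.aemeasurable]
  refine lintegral_mono fun ω => ?_
  calc ∫⁻ x, ‖K x ω * stft γ f x (-ω)‖ₑ ≤ ∫⁻ x, ‖K x ω‖ₑ * stftSup γ f (-ω) := by
        refine lintegral_mono fun x => ?_
        simp only [enorm_mul]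
        gcongr
        exact enorm_stft_le_stftSup γ f x (-ω)
    _ = (∫⁻ x, ‖K x ω‖ₑ) * stftSup γ f (-ω) := by
        refine lintegral_mul_const _ ?_
        exact (hK.comp_measurable (g := fun x => (x, ω)) (by fun_prop)).enorm
    _ ≤ _ := by gcongr; exact hk ω

theorem integrable_mul_stft {γ : 𝓢(Rd d, ℂ)} {f : BoundedContinuousFunction (Rd d) ℂ}
    (hf : ∫⁻ ω, stftSup γ f ω < ⊤)
    {K : Rd d → Rd d → ℂ} (hK : StronglyMeasurable (Function.uncurry K)) {k : ℝ≥0∞} (hk0 : k ≠ ⊤)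
    (hk : ∀ ω, ∫⁻ x, ‖K x ω‖ₑ ≤ k) :
    Integrable fun z : Rd d × Rd d => K z.1 z.2 * stft γ f z.1 (-z.2) := by
  refine ⟨?_, (lintegral_mul_stft_le hK hk).trans_lt ?_⟩
  · refine (hK.mul ?_).aestronglyMeasurable
    exact (stronglyMeasurable_stft γ f).comp_measurable (g := fun z : Rd d × Rd d => (z.1, -z.2))
      (by fun_prop)
  · rw [lintegral_const_mul' _ _ hk0, lintegral_neg_stftSup]
    exact ENNReal.mul_lt_top hk0.lt_top hf

theorem fourier_modulate (ν ζ : Rd d) (ψ : 𝓢(Rd d, ℂ)) :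
    𝓕 (modulate ν ψ) ζ = 𝓕 ψ (ζ - ν) := by
  simp only [fourier_coe, Real.fourier_eq]
  refine integral_congr_ae (Eventually.of_forall fun y => ?_)
  simp only [modulate_apply, Circle.smul_def, smul_eq_mul, ← mul_assoc, ← Circle.coe_mul,
    ← AddChar.map_add_eq_mul]
  congr 3
  rw [inner_sub_right, real_inner_comm y ν]
  ring

/-- The short-time Fourier transform of a Schwartz function decays rapidly. -/
theorem exists_norm_stft_le (η γ : 𝓢(Rd d, ℂ)) (N : ℕ) :
    ∃ C : ℝ, 0 ≤ C ∧ ∀ s ν, ‖stft η γ s ν‖ ≤ C * (weight N s * weight N ν) := by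
  -- Order `2N` is obtained in `s` directly and in `ν` on the Fourier side; the geometric mean of
  -- the two bounds gives order `N` in both variables at once.
  obtain ⟨A, hA, h1⟩ := exists_integral_mul_le_weight γ η (N + N)
  obtain ⟨B, hB, h2⟩ := exists_integral_mul_le_weight (𝓕⁻ γ) (𝓕 η) (N + N)
  refine ⟨√(A * B), Real.sqrt_nonneg _, fun s ν => ?_⟩
  have hA' : ‖stft η γ s ν‖ ≤ A * weight (N + N) s := by
    refine (norm_fourier_le_integral _ ν).trans ?_
    have := h1 1 (-s) (by simp)
    simpa only [one_smul, ← sub_eq_add_neg, weight_neg, norm_mul] using this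
  have hB' : ‖stft η γ s ν‖ ≤ B * weight (N + N) ν := by
    have e1 : stft η γ s ν = ∫ y, 𝓕 (𝓕⁻ γ) y * modulate (-ν) (translate s η) y := by
      rw [FourierTransform.fourier_fourierInv_eq, stft, Real.fourier_eq]
      refine integral_congr_ae (Eventually.of_forall fun y => ?_)
      simp only [modulate_apply, compSubConstCLM_apply, Circle.smul_def, smul_eq_mul,
        inner_neg_left, real_inner_comm y ν]
      ring
    rw [e1, integral_fourier_mul_eq]
    refine (norm_integral_le_integral_norm _).trans ?_
    have := h2 1 ν (by simp)
    simpa only [norm_mul, fourier_modulate, fourier_translate, modulate_apply, Circle.norm_coe,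
      one_mul, sub_neg_eq_add, one_smul] using this
  rw [weight_add] at hA' hB'
  have hw1 := weight_pos N s
  have hw2 := weight_pos N ν
  rw [← Real.sqrt_sq (show 0 ≤ weight N s * weight N ν by positivity), ← Real.sqrt_mul (by positivity)]
  refine Real.le_sqrt_of_sq_le ?_
  calc ‖stft η γ s ν‖ ^ 2 = ‖stft η γ s ν‖ * ‖stft η γ s ν‖ := sq _
    _ ≤ (A * (weight N s * weight N s)) * (B * (weight N ν * weight N ν)) := by gcongr
    _ = _ := by ring

/-- Covariance: a phase space shift of the function shifts its transform, up to a unimodular factor.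
-/
theorem stft_modulate_translate (η γ : 𝓢(Rd d, ℂ)) (x ω s ν : Rd d) :
    stft η (modulate (-ω) (translate x γ)) s ν =
      Real.fourierChar (-inner ℝ x (ν + ω)) * stft η γ (s - x) (ν + ω) := by
  rw [stft, stft, Real.fourier_eq, Real.fourier_eq, ← integral_const_mul,
    ← integral_sub_right_eq_self (fun y => (Real.fourierChar (-inner ℝ x (ν + ω)) : ℂ) *
      (Real.fourierChar (-inner ℝ y (ν + ω)) • (γ y * η (y - (s - x))))) x]
  refine integral_congr_ae (Eventually.of_forall fun y => ?_)
  simp only [modulate_apply, compSubConstCLM_apply, Circle.smul_def, smul_eq_mul,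
    sub_sub_sub_cancel_right]
  have h : (Real.fourierChar (-inner ℝ y ν) : ℂ) * Real.fourierChar (inner ℝ (-ω) y) =
      Real.fourierChar (-inner ℝ x (ν + ω)) * Real.fourierChar (-inner ℝ (y - x) (ν + ω)) := by
    rw [← Circle.coe_mul, ← Circle.coe_mul, ← AddChar.map_add_eq_mul, ← AddChar.map_add_eq_mul]
    congr 2
    simp only [inner_sub_left, inner_add_right, inner_neg_left, real_inner_comm ω y]
    ring
  linear_combination (γ (y - x) * η (y - s)) * h

theorem lintegral_weight_ne_top : ∫⁻ x : Rd d, ENNReal.ofReal (weight (d + 1) x) ≠ ⊤ := by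
  have h := (integrable_weight (d := d)).2
  rw [hasFiniteIntegral_iff_ofReal (Eventually.of_forall fun x => (weight_pos _ x).le)] at h
  exact h.ne

/-- Integrability of the supremum of the short-time Fourier transform does not depend on the
window. -/
theorem lintegral_stftSup_lt_top {γ₀ : 𝓢(Rd d, ℂ)} (hγ₀ : γ₀ ≠ 0)
    {f : BoundedContinuousFunction (Rd d) ℂ} (hf : ∫⁻ ω, stftSup γ₀ f ω < ⊤) (γ : 𝓢(Rd d, ℂ)) :
    ∫⁻ ω, stftSup γ f ω < ⊤ := by
  set η : 𝓢(Rd d, ℂ) := conjS γ₀ with hη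
  set c : ℂ := ∫ y, γ₀ y * η y with hc
  have hc0 : c ≠ 0 := by
    have := bracket_self_ne_zero hγ₀
    simpa [bracket, hc, hη] using this
  obtain ⟨C, hC, hdec⟩ := exists_norm_stft_le η γ (d + 1)
  let W : Rd d → ℝ≥0∞ := fun x => ENNReal.ofReal (weight (d + 1) x)
  have hWm : Measurable W := (continuous_weight _).measurable.ennreal_ofReal
  let I : ℝ≥0∞ := ∫⁻ x, W x
  have hI : I ≠ ⊤ := lintegral_weight_ne_top
  -- The value `stft γ f x ω` is the pairing of `f` with a phase space shift of `γ`. Duality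
  -- expresses it through the window `γ₀`, and the shifted kernel has an `x`-independent bound after
  -- integration in `s`.
  have key : ∀ x ω, ‖c‖ₑ * ‖stft γ f x ω‖ₑ ≤
      ∫⁻ ν, ENNReal.ofReal C * I * W (ν + ω) * stftSup γ₀ f (-ν) := by
    intro x ω
    let Ψs : 𝓢(Rd d, ℂ) := modulate (-ω) (translate x γ)
    let Ψ : BoundedContinuousFunction (Rd d) ℂ := Ψs.toBoundedContinuousFunction
    have hΨ : (Ψ : Rd d → ℂ) = Ψs := rfl
    have hk : ∀ ν, ∫⁻ s, ‖stft η Ψ s ν‖ₑ ≤ ENNReal.ofReal C * I * W (ν + ω) := by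
      intro ν
      have h1 : ∀ s, ‖stft η Ψ s ν‖ₑ ≤ ENNReal.ofReal C * W (ν + ω) * W (s - x) := by
        intro s
        have h2 : ‖stft η Ψ s ν‖ ≤ C * weight (d + 1) (ν + ω) * weight (d + 1) (s - x) := by
          rw [hΨ, stft_modulate_translate, norm_mul, Circle.norm_coe, one_mul, mul_assoc,
            mul_comm (weight _ (ν + ω))]
          exact hdec _ _
        rw [← ofReal_norm, ← ENNReal.ofReal_mul hC,
          ← ENNReal.ofReal_mul (mul_nonneg hC (weight_pos _ _).le)]
        exact ENNReal.ofReal_le_ofReal h2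
      refine (lintegral_mono h1).trans ?_
      rw [lintegral_const_mul _ (show Measurable fun s => W (s - x) from
          hWm.comp (measurable_sub_const x)),
        lintegral_sub_right_eq_self W x]
      exact le_of_eq (by ring)
    have hK := stronglyMeasurable_stft η Ψ
    have hk' : ∀ ν, ∫⁻ s, ‖stft η Ψ s ν‖ₑ ≤ ENNReal.ofReal C * I := fun ν => by
      refine (hk ν).trans (mul_le_of_le_one_right' ?_)
      exact ENNReal.ofReal_le_one.2 (weight_le_one _ _)
    have hinv := integral_stft_mul_stft hf (η := η) (Ψ := Ψ) Ψs.integrable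
      (integrable_mul_stft hf hK (ENNReal.mul_ne_top ENNReal.ofReal_ne_top hI) hk')
    have hst : ∫ y, Ψ y * f y = stft γ f x ω := by
      rw [stft, Real.fourier_eq]
      refine integral_congr_ae (Eventually.of_forall fun y => ?_)
      simp only [hΨ, Ψs, modulate_apply, compSubConstCLM_apply, Circle.smul_def, smul_eq_mul,
        inner_neg_left, real_inner_comm y ω]
      ring
    rw [hst] at hinv
    rw [← enorm_mul, ← hinv]
    exact (enorm_integral_le_lintegral_enorm _).trans (lintegral_mul_stft_le hK hk)
  have hc1 : ‖c‖ₑ ≠ 0 := by simpa using hc0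
  have hsup : ∀ ω, ‖c‖ₑ * stftSup γ f ω ≤
      ∫⁻ ν, ENNReal.ofReal C * I * W (ν + ω) * stftSup γ₀ f (-ν) := by
    intro ω
    rw [stftSup, ENNReal.mul_iSup]
    exact iSup_le fun x => key x ω
  have hSm : Measurable fun ν : Rd d => stftSup γ₀ f (-ν) :=
    (measurable_stftSup γ₀ f).comp measurable_neg
  have hfin : ‖c‖ₑ * ∫⁻ ω, stftSup γ f ω < ⊤ := by
    rw [← lintegral_const_mul _ (measurable_stftSup γ f)]
    refine (lintegral_mono hsup).trans_lt ?_
    -- By Tonelli and translation invariance, the convolution contributes one further factor `I`.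
    rw [lintegral_lintegral_swap]
    · have h1 : ∀ ν : Rd d, ∫⁻ ω, ENNReal.ofReal C * I * W (ν + ω) * stftSup γ₀ f (-ν) =
          ENNReal.ofReal C * I * I * stftSup γ₀ f (-ν) := by
        intro ν
        have h3 : Measurable fun ω => W (ν + ω) := hWm.comp (measurable_const_add ν)
        rw [lintegral_mul_const _ (h3.const_mul _), lintegral_const_mul _ h3,
          lintegral_add_left_eq_self W ν]
      simp only [h1]
      have h2 : ENNReal.ofReal C * I * I ≠ ⊤ :=
        ENNReal.mul_ne_top (ENNReal.mul_ne_top ENNReal.ofReal_ne_top hI) hI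
      rw [lintegral_const_mul _ hSm, lintegral_neg_stftSup]
      exact ENNReal.mul_lt_top h2.lt_top hf
    · refine Measurable.aemeasurable ?_
      rw [Function.uncurry_def]
      exact ((hWm.comp (measurable_snd.add measurable_fst)).const_mul _).mul
        (hSm.comp measurable_snd)
  exact ENNReal.lt_top_of_mul_ne_top_right hfin.ne hc1

end ShortTime

/-! ### Regularized Fresnel integrals -/

section Regularization

variable {d : ℕ}

theorem hasTemperateGrowth_fresnelFun (ħ : ℝ) (d : ℕ) : (fresnelFun ħ d).HasTemperateGrowth := by
  have h : (fun y : Rd d => (2 * ħ)⁻¹ * ‖y‖ ^ 2).HasTemperateGrowth :=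
    (Function.HasTemperateGrowth.const _).mul (Function.hasTemperateGrowth_norm_sq (H := Rd d))
  have h' := (Function.HasTemperateGrowth.const
    ((2 * (Real.pi : ℂ) * Complex.I * (ħ : ℂ)) ^ (-(d : ℂ) / 2))).mul
    (hasTemperateGrowth_cexp_I.comp h)
  have e : fresnelFun ħ d = (fun _ : Rd d =>
      (2 * (Real.pi : ℂ) * Complex.I * (ħ : ℂ)) ^ (-(d : ℂ) / 2)) *
      ((fun t : ℝ => Complex.exp (Complex.I * (t : ℂ))) ∘ fun y : Rd d => (2 * ħ)⁻¹ * ‖y‖ ^ 2) := by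
    funext y
    simp only [fresnelFun, Function.comp, Pi.mul_apply]
    congr 2
    push_cast
    ring
  rw [e]
  exact h'

theorem norm_fresnelFun (ħ : ℝ) (d : ℕ) (x : Rd d) :
    ‖fresnelFun ħ d x‖ = ‖(2 * (Real.pi : ℂ) * Complex.I * (ħ : ℂ)) ^ (-(d : ℂ) / 2)‖ := by
  have h : Complex.I / (2 * (ħ : ℂ)) * ((‖x‖ ^ 2 : ℝ) : ℂ)
      = ((‖x‖ ^ 2 / (2 * ħ) : ℝ) : ℂ) * Complex.I := by
    push_cast; ring
  rw [fresnelFun, norm_mul, h, Complex.norm_exp_ofReal_mul_I, mul_one]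

/-- The Fresnel function as a bounded continuous function. -/
def fresnelBounded (ħ : ℝ) (d : ℕ) : BoundedContinuousFunction (Rd d) ℂ :=
  BoundedContinuousFunction.ofNormedAddCommGroup (fresnelFun ħ d)
    (hasTemperateGrowth_fresnelFun ħ d).1.continuous _ fun x => (norm_fresnelFun ħ d x).le

/-- The regularized Fresnel function `F₊ φ(ε ·)`. -/
def fresnelCutoff (ħ : ℝ) (φ : 𝓢(Rd d, ℂ)) (ε : ℝ) : BoundedContinuousFunction (Rd d) ℂ :=
  fresnelBounded ħ d *
    φ.toBoundedContinuousFunction.compContinuous ⟨fun y => ε • y, continuous_const_smul ε⟩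

theorem fresnelCutoff_apply (ħ : ℝ) (φ : 𝓢(Rd d, ℂ)) (ε : ℝ) (y : Rd d) :
    fresnelCutoff ħ φ ε y = fresnelFun ħ d y * φ (ε • y) := rfl

theorem integrable_fresnelCutoff (ħ : ℝ) (φ : 𝓢(Rd d, ℂ)) {ε : ℝ} (hε : ε ≠ 0) :
    Integrable (fresnelCutoff ħ φ ε) :=
  (φ.integrable.comp_smul hε).bdd_mul (fresnelBounded ħ d).continuous.aestronglyMeasurable
    (Eventually.of_forall fun y => (norm_fresnelFun ħ d y).le)

/-- The chirp `F₊ η` of a Schwartz function. -/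
def chirp (ħ : ℝ) (η : 𝓢(Rd d, ℂ)) : 𝓢(Rd d, ℂ) :=
  SchwartzMap.smulLeftCLM ℂ (fresnelFun ħ d) η

theorem chirp_apply (ħ : ℝ) (η : 𝓢(Rd d, ℂ)) (y : Rd d) :
    chirp ħ η y = fresnelFun ħ d y * η y :=
  SchwartzMap.smulLeftCLM_apply_apply (hasTemperateGrowth_fresnelFun ħ d) η y

/-- Expanding `‖y + x‖²` turns translation of the chirp into modulation at frequency `x / (2πħ)`. -/
theorem fresnelFun_add {ħ : ℝ} (hħ : ħ ≠ 0) (x y : Rd d) :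
    fresnelFun ħ d (y + x) = Complex.exp (((‖x‖ ^ 2 / (2 * ħ) : ℝ) : ℂ) * Complex.I) *
      Real.fourierChar (inner ℝ y ((2 * Real.pi * ħ)⁻¹ • x)) * fresnelFun ħ d y := by
  have h1 : Complex.I / (2 * (ħ : ℂ)) * ((‖y + x‖ ^ 2 : ℝ) : ℂ) =
      ((‖x‖ ^ 2 / (2 * ħ) : ℝ) : ℂ) * Complex.I +
      ((2 * Real.pi * inner ℝ y ((2 * Real.pi * ħ)⁻¹ • x) : ℝ) : ℂ) * Complex.I +
      Complex.I / (2 * (ħ : ℂ)) * ((‖y‖ ^ 2 : ℝ) : ℂ) := by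
    have hħ' : (ħ : ℂ) ≠ 0 := by exact_mod_cast hħ
    have hπ : (Real.pi : ℂ) ≠ 0 := by exact_mod_cast Real.pi_ne_zero
    rw [norm_add_sq_real, inner_smul_right]
    push_cast
    field_simp
    ring
  rw [fresnelFun, fresnelFun, h1, Complex.exp_add, Complex.exp_add, Real.fourierChar_apply]
  ring

/-- After the shift `y ↦ y + x`, the variables `x` and `ω` enter the oscillation only through `ω - x
/ (2πħ)`. It is used with `p = 1` and with `p = φ(ε ·)`. -/
theorem norm_stft_fresnel_mul {ħ : ℝ} (hħ : ħ ≠ 0) (η : 𝓢(Rd d, ℂ)) (p : Rd d → ℂ) (x ω : Rd d) :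
    ‖stft η (fun y => fresnelFun ħ d y * p y) x ω‖ =
      ‖∫ y, p (y + x) * modulate (-(ω - (2 * Real.pi * ħ)⁻¹ • x)) (chirp ħ η) y‖ := by
  have h : stft η (fun y => fresnelFun ħ d y * p y) x ω =
      (Real.fourierChar (-inner ℝ x ω) *
        Complex.exp (((‖x‖ ^ 2 / (2 * ħ) : ℝ) : ℂ) * Complex.I)) *
      ∫ y, p (y + x) * modulate (-(ω - (2 * Real.pi * ħ)⁻¹ • x)) (chirp ħ η) y := by
    rw [stft, Real.fourier_eq, ← integral_const_mul, ← integral_add_right_eq_self _ x]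
    refine integral_congr_ae (Eventually.of_forall fun y => ?_)
    simp only [Circle.smul_def, smul_eq_mul, modulate_apply, chirp_apply, add_sub_cancel_right,
      fresnelFun_add hħ]
    have h1 : (Real.fourierChar (-inner ℝ (y + x) ω) : ℂ) *
        Real.fourierChar (inner ℝ y ((2 * Real.pi * ħ)⁻¹ • x)) =
        Real.fourierChar (-inner ℝ x ω) *
          Real.fourierChar (inner ℝ (-(ω - (2 * Real.pi * ħ)⁻¹ • x)) y) := by
      rw [← Circle.coe_mul, ← Circle.coe_mul, ← AddChar.map_add_eq_mul, ← AddChar.map_add_eq_mul]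
      congr 2
      rw [inner_neg_left, inner_sub_left, inner_add_left, real_inner_comm y ω,
        real_inner_comm y (_ • x)]
      ring
    linear_combination (Complex.exp (((‖x‖ ^ 2 / (2 * ħ) : ℝ) : ℂ) * Complex.I) *
      fresnelFun ħ d y * p (y + x) * η y) * h1
  rw [h, norm_mul, norm_mul, Circle.norm_coe, Complex.norm_exp_ofReal_mul_I, one_mul, one_mul]

theorem exists_norm_stft_fresnel_le {ħ : ℝ} (hħ : ħ ≠ 0) (η : 𝓢(Rd d, ℂ)) (N : ℕ) :
    ∃ C : ℝ, 0 ≤ C ∧ ∀ x ω, ‖stft η (fresnelBounded ħ d) x ω‖ ≤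
      C * weight N (ω - (2 * Real.pi * ħ)⁻¹ • x) := by
  obtain ⟨C, hC, h⟩ := exists_norm_le_weight (𝓕 (chirp ħ η)) N
  refine ⟨C, hC, fun x ω => ?_⟩
  have h1 := norm_stft_fresnel_mul hħ η (fun _ => 1) x ω
  have h2 : ∫ y, modulate (-(ω - (2 * Real.pi * ħ)⁻¹ • x)) (chirp ħ η) y =
      𝓕 (chirp ħ η) (ω - (2 * Real.pi * ħ)⁻¹ • x) := by
    rw [fourier_coe, Real.fourier_eq]
    refine integral_congr_ae (Eventually.of_forall fun y => ?_)
    simp only [modulate_apply, Circle.smul_def, smul_eq_mul, real_inner_comm y, inner_neg_right]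
  simp only [one_mul, mul_one, h2] at h1
  change ‖stft η (fun y => fresnelFun ħ d y) x ω‖ ≤ _
  rw [h1]
  exact h _

/-- The short-time Fourier transforms of the regularized Fresnel functions are concentrated near
the graph of a linear map, uniformly in the regularization parameter. -/
theorem exists_norm_stft_fresnelCutoff_le {ħ : ℝ} (hħ : ħ ≠ 0) (η φ : 𝓢(Rd d, ℂ)) (N : ℕ) :
    ∃ C : ℝ, 0 ≤ C ∧ ∀ (ε : ℝ) (x ω : Rd d), |ε| ≤ 1 → ‖stft η (fresnelCutoff ħ φ ε) x ω‖ ≤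
      C * weight N (ω - (2 * Real.pi * ħ)⁻¹ • x) := by
  obtain ⟨C, hC, h⟩ := exists_integral_mul_le_weight (𝓕⁻ φ) (𝓕 (chirp ħ η)) N
  refine ⟨C, hC, fun ε x ω hε => ?_⟩
  set ζ := ω - (2 * Real.pi * ħ)⁻¹ • x with hζ
  set X : 𝓢(Rd d, ℂ) := modulate (-ζ) (chirp ħ η) with hX
  set a : 𝓢(Rd d, ℂ) := modulate (-(ε • x)) (𝓕⁻ φ) with ha
  -- Putting `ε` into the Fourier pairing represents `φ (ε • (y + x))` as a transform of `a` without
  -- rescaling `a`, so no negative power of `ε` appears.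
  let L : Rd d →ₗ[ℝ] Rd d →ₗ[ℝ] ℝ := ε • innerₗ (Rd d)
  have hL : Continuous fun p : Rd d × Rd d => L p.1 p.2 := by
    simp only [L, LinearMap.smul_apply, innerₗ_apply_apply]
    fun_prop
  have h1 := VectorFourier.integral_bilin_fourierIntegral_eq_flip (μ := volume) (ν := volume)
    (ContinuousLinearMap.mul ℂ ℂ) (L := L) Real.continuous_fourierChar hL a.integrable X.integrable
  simp only [ContinuousLinearMap.mul_apply'] at h1
  have h2 : ∀ y, VectorFourier.fourierIntegral Real.fourierChar volume L a y = φ (ε • (y + x)) := by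
    intro y
    have e : φ (ε • (y + x)) = 𝓕 (𝓕⁻ φ) (ε • (y + x)) := by
      rw [FourierTransform.fourier_fourierInv_eq]
    rw [e, fourier_coe, Real.fourier_eq, VectorFourier.fourierIntegral]
    refine integral_congr_ae (Eventually.of_forall fun κ => ?_)
    simp only [ha, modulate_apply, Circle.smul_def, smul_eq_mul, ← mul_assoc, ← Circle.coe_mul,
      ← AddChar.map_add_eq_mul, L, LinearMap.smul_apply, innerₗ_apply_apply]
    congr 3
    rw [inner_smul_right, inner_add_right, inner_neg_left, real_inner_smul_left,
      real_inner_comm x κ]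
    ring
  have h3 : ∀ κ, VectorFourier.fourierIntegral Real.fourierChar volume L.flip X κ =
      𝓕 (chirp ħ η) (ε • κ + ζ) := by
    intro κ
    rw [fourier_coe, Real.fourier_eq, VectorFourier.fourierIntegral]
    refine integral_congr_ae (Eventually.of_forall fun y => ?_)
    simp only [hX, modulate_apply, Circle.smul_def, smul_eq_mul, ← mul_assoc, ← Circle.coe_mul,
      ← AddChar.map_add_eq_mul, L, LinearMap.smul_apply, innerₗ_apply_apply, LinearMap.flip_apply]
    congr 3
    rw [inner_add_right, inner_neg_left, inner_smul_right, real_inner_comm y κ, real_inner_comm y ζ]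
    ring
  simp only [h2, h3] at h1
  have h4 := norm_stft_fresnel_mul hħ η (fun y => φ (ε • y)) x ω
  change ‖stft η (fun y => fresnelFun ħ d y * φ (ε • y)) x ω‖ ≤ _
  rw [h4, h1]
  refine (norm_integral_le_integral_norm _).trans ?_
  have h5 := h ε ζ hε
  simpa only [ha, norm_mul, modulate_apply, Circle.norm_coe, one_mul] using h5

theorem tendsto_stft_fresnelCutoff (ħ : ℝ) (η : 𝓢(Rd d, ℂ)) {φ : 𝓢(Rd d, ℂ)} (hφ : φ 0 = 1)
    (x ω : Rd d) : Tendsto (fun ε : ℝ => stft η (fresnelCutoff ħ φ ε) x ω) (𝓝[>] 0)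
      (𝓝 (stft η (fresnelBounded ħ d) x ω)) := by
  simp only [stft, Real.fourier_eq]
  obtain ⟨C, -, hC⟩ := exists_norm_le_weight φ 0
  let A := ‖(2 * (Real.pi : ℂ) * Complex.I * (ħ : ℂ)) ^ (-(d : ℂ) / 2)‖
  refine tendsto_integral_filter_of_dominated_convergence (fun y => A * C * ‖η (y - x)‖) ?_ ?_ ?_ ?_
  · refine Eventually.of_forall fun ε => ?_
    exact ((Real.fourierIntegral_convergent_iff ω).2
      (integrable_mul_window η (fresnelCutoff ħ φ ε) x)).aestronglyMeasurable
  · refine Eventually.of_forall fun ε => Eventually.of_forall fun y => ?_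
    rw [Circle.norm_smul, norm_mul, fresnelCutoff_apply, norm_mul, norm_fresnelFun]
    have := hC (ε • y)
    simp only [weight, pow_zero, inv_one, mul_one] at this
    gcongr
  · exact (η.integrable.comp_sub_right x).norm.const_mul _
  · refine Eventually.of_forall fun y => ?_
    have h1 : Tendsto (fun ε : ℝ => φ (ε • y)) (𝓝[>] 0) (𝓝 1) := by
      have h2 : Continuous fun ε : ℝ => φ (ε • y) := φ.continuous.comp (by fun_prop)
      have h3 := h2.tendsto 0
      rw [zero_smul, hφ] at h3
      exact h3.mono_left nhdsWithin_le_nhds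
    have h2 := ((h1.const_mul (fresnelFun ħ d y)).mul_const (η (y - x))).const_smul
      (Real.fourierChar (-inner ℝ y ω))
    rw [mul_one] at h2
    exact h2

/-- Since `r ≠ 0`, translating `x` by `r⁻¹ • ω` removes `ω` from the integral. -/
theorem exists_lintegral_weight_sub_smul {r : ℝ} (hr : r ≠ 0) (C : ℝ) : ∃ k : ℝ≥0∞, k ≠ ⊤ ∧
    ∀ ω : Rd d, ∫⁻ x : Rd d, ‖((C * weight (d + 1) (ω - r • x) : ℝ) : ℂ)‖ₑ ≤ k := by
  have hI : Integrable fun x : Rd d => C * weight (d + 1) (r • x) :=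
    (integrable_weight.comp_smul hr).const_mul C
  refine ⟨∫⁻ x : Rd d, ‖C * weight (d + 1) (r • x)‖ₑ, hI.2.ne, fun ω => ?_⟩
  rw [← lintegral_sub_right_eq_self (fun x : Rd d => ‖C * weight (d + 1) (r • x)‖ₑ) (r⁻¹ • ω)]
  refine lintegral_mono fun x => le_of_eq ?_
  have h1 : r • (x - r⁻¹ • ω) = -(ω - r • x) := by
    rw [smul_sub, smul_inv_smul₀ hr, neg_sub]
  simp only [h1, weight_neg]
  rw [← enorm_norm, Complex.norm_real, enorm_norm]

/-- Convergence of the regularized Fresnel integrals. -/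
theorem tendsto_integral_fresnelCutoff_mul {ħ : ℝ} (hħ : 0 < ħ) {γ : 𝓢(Rd d, ℂ)}
    {f : BoundedContinuousFunction (Rd d) ℂ} (hf : ∫⁻ ω, stftSup γ f ω < ⊤) (η : 𝓢(Rd d, ℂ)) :
    Integrable (fun z : Rd d × Rd d =>
      stft η (fresnelBounded ħ d) z.1 z.2 * stft γ f z.1 (-z.2)) ∧
    ∀ φ : 𝓢(Rd d, ℂ), φ 0 = 1 →
      Tendsto (fun ε : ℝ => (∫ y, γ y * η y) * ∫ y, fresnelCutoff ħ φ ε y * f y) (𝓝[>] 0)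
        (𝓝 (∫ z : Rd d × Rd d, stft η (fresnelBounded ħ d) z.1 z.2 * stft γ f z.1 (-z.2))) := by
  have hr : (2 * Real.pi * ħ)⁻¹ ≠ 0 := by positivity
  -- The majorant `B` depends only on `C`, so it dominates the whole family of cutoffs.
  have hmaj : ∀ C : ℝ, 0 ≤ C → ∃ B : Rd d × Rd d → ℝ, Integrable B ∧
      ∀ K : BoundedContinuousFunction (Rd d) ℂ,
        (∀ x ω, ‖stft η K x ω‖ ≤ C * weight (d + 1) (ω - (2 * Real.pi * ħ)⁻¹ • x)) →
        (∀ z : Rd d × Rd d, ‖stft η K z.1 z.2 * stft γ f z.1 (-z.2)‖ ≤ B z) ∧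
        Integrable fun z : Rd d × Rd d => stft η K z.1 z.2 * stft γ f z.1 (-z.2) := by
    intro C hC
    obtain ⟨k, hk0, hk⟩ := exists_lintegral_weight_sub_smul (d := d) hr C
    have hI := integrable_mul_stft hf
      (K := fun x ω => ((C * weight (d + 1) (ω - (2 * Real.pi * ħ)⁻¹ • x) : ℝ) : ℂ)) ?_ hk0 hk
    · refine ⟨_, hI.norm, fun K hK => ?_⟩
      have hle : ∀ z : Rd d × Rd d, ‖stft η K z.1 z.2 * stft γ f z.1 (-z.2)‖ ≤
          ‖((C * weight (d + 1) (z.2 - (2 * Real.pi * ħ)⁻¹ • z.1) : ℝ) : ℂ) *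
            stft γ f z.1 (-z.2)‖ := by
        intro z
        rw [norm_mul, norm_mul, Complex.norm_real, Real.norm_of_nonneg
          (mul_nonneg hC (weight_pos _ _).le)]
        gcongr
        exact hK _ _
      refine ⟨hle, hI.norm.mono' ((stronglyMeasurable_stft η K).mul ?_).aestronglyMeasurable
        (Eventually.of_forall hle)⟩
      exact (stronglyMeasurable_stft γ f).comp_measurable
        (g := fun z : Rd d × Rd d => (z.1, -z.2)) (by fun_prop)
    · refine Continuous.stronglyMeasurable (Complex.continuous_ofReal.comp
        (continuous_const.mul ((continuous_weight _).comp ?_)))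
      fun_prop
  constructor
  · obtain ⟨C, hC, h⟩ := exists_norm_stft_fresnel_le hħ.ne' η (d + 1)
    obtain ⟨B, -, hK⟩ := hmaj C hC
    exact (hK _ h).2
  · intro φ hφ
    obtain ⟨C, hC, h⟩ := exists_norm_stft_fresnelCutoff_le hħ.ne' η φ (d + 1)
    obtain ⟨B, hB, hK⟩ := hmaj C hC
    have hε : ∀ᶠ ε : ℝ in 𝓝[>] 0, 0 < ε ∧ |ε| ≤ 1 := by
      filter_upwards [Ioc_mem_nhdsGT (zero_lt_one' ℝ)] with ε hε
      exact ⟨hε.1, by rw [abs_of_pos hε.1]; exact hε.2⟩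
    have hlim : Tendsto (fun ε : ℝ => ∫ z : Rd d × Rd d,
        stft η (fresnelCutoff ħ φ ε) z.1 z.2 * stft γ f z.1 (-z.2)) (𝓝[>] 0)
        (𝓝 (∫ z : Rd d × Rd d, stft η (fresnelBounded ħ d) z.1 z.2 * stft γ f z.1 (-z.2))) := by
      refine tendsto_integral_filter_of_dominated_convergence B ?_ ?_ hB ?_
      · filter_upwards [hε] with ε h1
        exact (hK _ fun x ω => h ε x ω h1.2).2.aestronglyMeasurable
      · filter_upwards [hε] with ε h1
        exact Eventually.of_forall (hK _ fun x ω => h ε x ω h1.2).1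
      · exact Eventually.of_forall fun z =>
          (tendsto_stft_fresnelCutoff ħ η hφ z.1 z.2).mul_const _
    refine hlim.congr' ?_
    filter_upwards [hε] with ε h1
    exact integral_stft_mul_stft hf (integrable_fresnelCutoff ħ φ h1.1.ne')
      (hK _ fun x ω => h ε x ω h1.2).2

end Regularization

/-! ### The Gabor transform and the short-time Fourier transform -/

section Comparison

variable {d : ℕ}

/-- The normalization constant of the phase space shifts. -/
def shiftConst (ħ : ℝ) (d : ℕ) : ℝ := (2 * Real.pi * ħ) ^ (-(d : ℝ) / 2)

/-- The two normalizations in the product of Gabor transforms cancel the Jacobian of `ξ ↦ ξ /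
(2πħ)`. -/
theorem shiftConst_sq {ħ : ℝ} (hħ : 0 < ħ) (d : ℕ) :
    shiftConst ħ d * shiftConst ħ d * (2 * Real.pi * ħ) ^ d = 1 := by
  have h : 0 < 2 * Real.pi * ħ := by positivity
  rw [shiftConst, ← Real.rpow_natCast, ← Real.rpow_add h, ← Real.rpow_add h]
  ring_nf
  exact Real.rpow_zero _

theorem phaseShift_eq {ħ : ℝ} (hħ : ħ ≠ 0) (x ξ : Rd d) (g : 𝓢(Rd d, ℂ)) :
    phaseShift ħ x ξ g =
      (shiftConst ħ d : ℂ) • modulate ((2 * Real.pi * ħ)⁻¹ • ξ) (translate x g) := by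
  ext y
  rw [phaseShift_apply, smul_apply, smul_eq_mul, modulate_apply, Real.fourierChar_apply,
    compSubConstCLM_apply, shiftConst, real_inner_smul_left]
  congr 3
  have hħ' : (ħ : ℂ) ≠ 0 := by exact_mod_cast hħ
  have hπ : (Real.pi : ℂ) ≠ 0 := by exact_mod_cast Real.pi_ne_zero
  push_cast
  field_simp

theorem conjS_phaseShift {ħ : ℝ} (hħ : ħ ≠ 0) (x ξ : Rd d) (g : 𝓢(Rd d, ℂ)) :
    conjS (phaseShift ħ x ξ g) =
      (shiftConst ħ d : ℂ) • modulate (-((2 * Real.pi * ħ)⁻¹ • ξ)) (translate x (conjS g)) := by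
  ext y
  rw [phaseShift_eq hħ]
  simp only [conjS_apply, smul_apply, smul_eq_mul, modulate_apply, compSubConstCLM_apply, map_mul,
    Complex.conj_ofReal, inner_neg_left, ← Circle.coe_inv_eq_conj, AddChar.map_neg_eq_inv]

theorem integral_modulate_translate_mul (γ : 𝓢(Rd d, ℂ)) (f : Rd d → ℂ) (x ω : Rd d) :
    ∫ y, modulate ω (translate x γ) y * f y = stft γ f x (-ω) := by
  rw [stft, Real.fourier_eq]
  refine integral_congr_ae (Eventually.of_forall fun y => ?_)
  simp only [modulate_apply, compSubConstCLM_apply, Circle.smul_def, smul_eq_mul, inner_neg_right,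
    neg_neg, real_inner_comm y ω]
  ring

theorem apply_modulate_translate {u : 𝓢'(Rd d, ℂ)} {f : Rd d → ℂ} (h : IsGivenBy u f)
    (γ : 𝓢(Rd d, ℂ)) (x ω : Rd d) : u (modulate ω (translate x γ)) = stft γ f x (-ω) := by
  rw [(h _).2, integral_modulate_translate_mul]

theorem gabor_eq {ħ : ℝ} (hħ : ħ ≠ 0) {u : 𝓢'(Rd d, ℂ)} {f : Rd d → ℂ} (h : IsGivenBy u f)
    (g : 𝓢(Rd d, ℂ)) (x ξ : Rd d) :
    gabor ħ g u x ξ = shiftConst ħ d * stft (conjS g) f x ((2 * Real.pi * ħ)⁻¹ • ξ) := by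
  rw [gabor, conjS_phaseShift hħ, map_smul, smul_eq_mul, apply_modulate_translate h, neg_neg]

/-- The two conjugations make the pairing bilinear: the window is not conjugated and the frequency
changes sign, as in `integral_stft_mul_stft`. -/
theorem gaborConj_eq_stft {ħ : ℝ} (hħ : ħ ≠ 0) {u : 𝓢'(Rd d, ℂ)} {f : Rd d → ℂ}
    (h : IsGivenBy u f) (γ : 𝓢(Rd d, ℂ)) (x ξ : Rd d) :
    gaborConj ħ γ u x ξ = shiftConst ħ d * stft γ f x (-((2 * Real.pi * ħ)⁻¹ • ξ)) := by
  rw [gaborConj_eq, phaseShift_eq hħ, map_smul, smul_eq_mul, apply_modulate_translate h]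

theorem isGivenBy_fresnelDist (ħ : ℝ) (d : ℕ) :
    IsGivenBy (fresnelDist ħ d) (fresnelBounded ħ d) := fun φ =>
  ⟨φ.integrable.mul_bdd (fresnelBounded ħ d).continuous.aestronglyMeasurable
    (Eventually.of_forall fun y => (fresnelBounded ħ d).norm_coe_le_norm y), fresnelDist_apply ħ d φ⟩

theorem map_smul_volume {r : ℝ} (hr : r ≠ 0) :
    Measure.map (fun x : Rd d => r • x) volume = ENNReal.ofReal |(r ^ d)⁻¹| • volume := by
  have h := Measure.map_addHaar_smul (volume : Measure (Rd d)) hr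
  simpa using h

theorem lintegral_comp_smul {r : ℝ} (hr : r ≠ 0) (h : Rd d → ℝ≥0∞) :
    ∫⁻ x, h (r • x) = ENNReal.ofReal |(r ^ d)⁻¹| * ∫⁻ x, h x := by
  have h1 := lintegral_map_equiv (μ := volume) h (Homeomorph.smulOfNeZero r hr).toMeasurableEquiv
  have h2 : Measure.map (Homeomorph.smulOfNeZero r hr).toMeasurableEquiv (volume : Measure (Rd d)) =
      ENNReal.ofReal |(r ^ d)⁻¹| • volume := map_smul_volume hr
  rw [h2, lintegral_smul_measure] at h1
  exact h1.symm

theorem integrable_and_integral_comp_smul_snd {r : ℝ} (hr : r ≠ 0) {H : Rd d × Rd d → ℂ}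
    (hH : Integrable H) : Integrable (fun z : Rd d × Rd d => H (z.1, r • z.2)) ∧
      ∫ z : Rd d × Rd d, H (z.1, r • z.2) = |(r ^ d)⁻¹| • ∫ z, H z := by
  let e : (Rd d × Rd d) ≃ᵐ (Rd d × Rd d) :=
    (MeasurableEquiv.refl _).prodCongr (Homeomorph.smulOfNeZero r hr).toMeasurableEquiv
  have he : ∀ z, e z = (z.1, r • z.2) := fun z => rfl
  have hmap : Measure.map e volume = ENNReal.ofReal |(r ^ d)⁻¹| • volume := by
    have h1 := Measure.map_prod_map (volume : Measure (Rd d)) (volume : Measure (Rd d))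
      (f := id) (g := fun x : Rd d => r • x) measurable_id (measurable_const_smul r)
    rw [Measure.map_id, map_smul_volume hr, Measure.prod_smul_right] at h1
    exact h1.symm
  have hH' : Integrable H (Measure.map e volume) := by
    rw [hmap]
    exact hH.smul_measure ENNReal.ofReal_ne_top
  refine ⟨(integrable_map_equiv e H).1 hH', ?_⟩
  have h2 := integral_map_equiv (μ := volume) e H
  rw [hmap, integral_smul_measure, ENNReal.toReal_ofReal (abs_nonneg _)] at h2
  exact h2.symm

/-- The normalization and the dilation `ξ ↦ -ξ / (2πħ)` change the integral only by nonzero factors.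
-/
theorem lintegral_windowSup_lt_top {ħ : ℝ} (hħ : 0 < ħ) {u : 𝓢'(Rd d, ℂ)} {g : 𝓢(Rd d, ℂ)}
    (h : ∫⁻ ξ : Rd d, ⨆ x : Rd d, ‖gabor ħ g u x ξ‖ₑ < ⊤) :
    ∫⁻ ω, windowSup u (conjS g) ω < ⊤ := by
  have hr : -(2 * Real.pi * ħ)⁻¹ ≠ 0 := neg_ne_zero.2 (by positivity)
  have hc : ‖(shiftConst ħ d : ℂ)‖ₑ ≠ 0 := by
    have : shiftConst ħ d ≠ 0 := (Real.rpow_pos_of_pos (by positivity) _).ne'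
    simpa using this
  have h1 : ∀ ξ, ⨆ x : Rd d, ‖gabor ħ g u x ξ‖ₑ =
      ‖(shiftConst ħ d : ℂ)‖ₑ * windowSup u (conjS g) (-(2 * Real.pi * ħ)⁻¹ • ξ) := by
    intro ξ
    rw [windowSup, ENNReal.mul_iSup]
    refine iSup_congr fun x => ?_
    rw [gabor, conjS_phaseShift hħ.ne', map_smul, smul_eq_mul, enorm_mul, neg_smul]
  simp only [h1] at h
  rw [lintegral_const_mul' _ _ enorm_ne_top, lintegral_comp_smul hr] at h
  refine ENNReal.lt_top_of_mul_ne_top_right (ENNReal.lt_top_of_mul_ne_top_right h.ne hc).ne ?_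
  rw [Ne, ENNReal.ofReal_eq_zero, not_le]
  exact abs_pos.2 (inv_ne_zero (pow_ne_zero _ hr))

theorem lintegral_stftSup_eq {u : 𝓢'(Rd d, ℂ)} {f : Rd d → ℂ} (h : IsGivenBy u f)
    (γ : 𝓢(Rd d, ℂ)) : ∫⁻ ω, stftSup γ f ω = ∫⁻ ω, windowSup u γ ω := by
  rw [← lintegral_neg_stftSup]
  simp only [stftSup, windowSup, apply_modulate_translate h]

/-- The function giving a tempered distribution is unique up to null sets. -/
theorem IsGivenBy.ae_eq {u : 𝓢'(Rd d, ℂ)} {f f' : Rd d → ℂ} (h : IsGivenBy u f)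
    (h' : IsGivenBy u f') : f =ᵐ[volume] f' := by
  -- Testing against a smooth bump equal to `1` near a point yields integrability there.
  have key : ∀ {f : Rd d → ℂ}, IsGivenBy u f → LocallyIntegrable f := by
    intro f hf x
    let b : ContDiffBump x := default
    have hs : HasCompactSupport fun y => (b y : ℂ) :=
      b.hasCompactSupport.comp_left (g := Complex.ofReal) Complex.ofReal_zero
    let φ : 𝓢(Rd d, ℂ) := hs.toSchwartzMap (Complex.ofRealCLM.contDiff.comp b.contDiff)
    refine ⟨Metric.closedBall x b.rIn, Metric.closedBall_mem_nhds x b.rIn_pos, ?_⟩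
    refine ((hf φ).1.integrableOn (s := Metric.closedBall x b.rIn)).congr_fun (fun y hy => ?_)
      Metric.isClosed_closedBall.measurableSet
    have : φ y = 1 := by
      change (b y : ℂ) = 1
      rw [b.one_of_mem_closedBall hy, Complex.ofReal_one]
    simp only [this, one_mul]
  refine ae_eq_of_integral_contDiff_smul_eq (key h) (key h') fun b hb hbs => ?_
  have hs : HasCompactSupport fun y => (b y : ℂ) :=
    hbs.comp_left (g := Complex.ofReal) Complex.ofReal_zero
  let φ : 𝓢(Rd d, ℂ) := hs.toSchwartzMap (Complex.ofRealCLM.contDiff.comp hb)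
  have := (h φ).2.symm.trans (h' φ).2
  simp only [Complex.real_smul]
  exact this

end Comparison

/-! ### The Fresnel integral as a phase space integral -/

section Main

variable {d : ℕ}

/-- The Fresnel integral of a function giving a distribution in the Sjöstrand class, in terms of
Gabor transforms. -/
theorem hasFresnelIntegral_of_isGivenBy {ħ : ℝ} (hħ : 0 < ħ) {u : 𝓢'(Rd d, ℂ)}
    {f₀ : BoundedContinuousFunction (Rd d) ℂ} (h₀ : IsGivenBy u f₀)
    {γ : 𝓢(Rd d, ℂ)} (hγ : ∫⁻ ω, stftSup γ f₀ ω < ⊤) {f : Rd d → ℂ} (hf : IsGivenBy u f)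
    {g : 𝓢(Rd d, ℂ)} (hg : bracket γ g ≠ 0) :
    Integrable (fun z : Rd d × Rd d =>
      gabor ħ g (fresnelDist ħ d) z.1 z.2 * gaborConj ħ γ u z.1 z.2) ∧
    HasFresnelIntegral ħ f ((bracket γ g)⁻¹ * ∫ z : Rd d × Rd d,
      gabor ħ g (fresnelDist ħ d) z.1 z.2 * gaborConj ħ γ u z.1 z.2) := by
  have hr : (2 * Real.pi * ħ)⁻¹ ≠ 0 := by positivity
  obtain ⟨hI, hlim⟩ := tendsto_integral_fresnelCutoff_mul hħ hγ (conjS g)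
  obtain ⟨hI', hval⟩ := integrable_and_integral_comp_smul_snd hr hI
  have hprod : ∀ z : Rd d × Rd d, gabor ħ g (fresnelDist ħ d) z.1 z.2 * gaborConj ħ γ u z.1 z.2 =
      ((shiftConst ħ d : ℂ) * shiftConst ħ d) *
        (stft (conjS g) (fresnelBounded ħ d) z.1 ((2 * Real.pi * ħ)⁻¹ • z.2) *
          stft γ f₀ z.1 (-((2 * Real.pi * ħ)⁻¹ • z.2))) := by
    intro z
    rw [gabor_eq hħ.ne' (isGivenBy_fresnelDist ħ d), gaborConj_eq_stft hħ.ne' h₀]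
    ring
  simp only [hprod]
  refine ⟨hI'.const_mul _, ?_⟩
  have hone : ((shiftConst ħ d : ℂ) * shiftConst ħ d) *
      ((|(((2 * Real.pi * ħ)⁻¹) ^ d)⁻¹| : ℝ) : ℂ) = 1 := by
    rw [abs_of_pos (by positivity), ← inv_pow, inv_inv]
    exact_mod_cast shiftConst_sq hħ d
  rw [integral_const_mul, hval, Complex.real_smul, ← mul_assoc (_ * _), hone, one_mul]
  have hae := hf.ae_eq h₀
  intro φ hφ
  have hA : (2 * (Real.pi : ℂ) * Complex.I * (ħ : ℂ)) ^ (-(d : ℂ) / 2) ≠ 0 := by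
    have hħ' : (ħ : ℂ) ≠ 0 := by exact_mod_cast hħ.ne'
    have hπ : (Real.pi : ℂ) ≠ 0 := by exact_mod_cast Real.pi_ne_zero
    have h1 : 2 * (Real.pi : ℂ) * Complex.I * (ħ : ℂ) ≠ 0 :=
      mul_ne_zero (mul_ne_zero (mul_ne_zero two_ne_zero hπ) Complex.I_ne_zero) hħ'
    rw [Ne, Complex.cpow_eq_zero_iff]
    exact fun h => h1 h.1
  -- Only almost everywhere equality with `f₀` is available, and it suffices under the integral.
  have hcongr : ∀ ε : ℝ, (fun x : Rd d =>
      Complex.exp (Complex.I / (2 * (ħ : ℂ)) * ((‖x‖ ^ 2 : ℝ) : ℂ)) * f x * φ (ε • x)) =ᵐ[volume]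
      fun x => ((2 * (Real.pi : ℂ) * Complex.I * (ħ : ℂ)) ^ (-(d : ℂ) / 2))⁻¹ *
        (fresnelCutoff ħ φ ε x * f₀ x) := by
    intro ε
    filter_upwards [hae] with x hx
    rw [hx, fresnelCutoff_apply, fresnelFun, mul_assoc _ (Complex.exp _), mul_assoc _ _ (f₀ x),
      inv_mul_cancel_left₀ hA]
    ring
  constructor
  · intro ε hε
    rw [integrable_congr (hcongr ε)]
    exact ((integrable_fresnelCutoff ħ φ hε.ne').mul_bdd f₀.continuous.aestronglyMeasurable
      (Eventually.of_forall fun y => f₀.norm_coe_le_norm y)).const_mul _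
  · refine ((hlim φ hφ).const_mul (bracket γ g)⁻¹).congr fun ε => ?_
    rw [integral_congr_ae (hcongr ε), integral_const_mul, mul_inv_cancel_left₀ hA]
    exact inv_mul_cancel_left₀ hg _

end Main
end FresnelSjostrand

end

open FresnelSjostrand
theorem theorem3p3 (d : ℕ) (ħ : ℝ) (hħ : 0 < ħ) (u : 𝓢'(Rd d, ℂ)) (hu : u ∈ sjostrandClass ħ d) :
    (∃ f : BoundedContinuousFunction (Rd d) ℂ, IsGivenBy u f) ∧
    ∀ f : Rd d → ℂ, IsGivenBy u f →
      FresnelIntegrable ħ f ∧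
      ∀ g γ : 𝓢(Rd d, ℂ), bracket γ g ≠ 0 →
        Integrable (fun z : Rd d × Rd d =>
          gabor ħ g (fresnelDist ħ d) z.1 z.2 * gaborConj ħ γ u z.1 z.2) ∧
        HasFresnelIntegral ħ f ((bracket γ g)⁻¹ *
          ∫ z : Rd d × Rd d,
            gabor ħ g (fresnelDist ħ d) z.1 z.2 * gaborConj ħ γ u z.1 z.2) := by
  obtain ⟨g₀, hg₀, hfin⟩ := hu
  have hg₀' : conjS g₀ ≠ 0 := by
    intro h
    refine hg₀ (SchwartzMap.ext fun y => ?_)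
    have := congrArg (fun φ : 𝓢(Rd d, ℂ) => φ y) h
    simpa using this
  have hwin := lintegral_windowSup_lt_top hħ hfin
  obtain ⟨f₀, h₀⟩ := exists_boundedContinuous_isGivenBy hwin hg₀'
  rw [← lintegral_stftSup_eq h₀] at hwin
  refine ⟨⟨f₀, h₀⟩, fun f hf => ?_⟩
  have key : ∀ g γ : 𝓢(Rd d, ℂ), bracket γ g ≠ 0 → _ := fun g γ hgγ =>
    hasFresnelIntegral_of_isGivenBy hħ h₀ (lintegral_stftSup_lt_top hg₀' hwin γ) hf hgγ
  -- The pair `(g₀, g₀)` has nonzero bracket and so exhibits a value of the Fresnel integral.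
  exact ⟨⟨_, (key g₀ g₀ (bracket_self_ne_zero hg₀)).2⟩, key⟩
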